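/- **Setting.** Let $N,M,K$ be natural numbers, $X\in\mathbb R^{N\times M}$ a matrix with rows $x_1^\top,\dots,x_N^\top$, $Y=(y_{ik})\in\{0,1\}^{N\times K}$ observed responses, $\mu_0\in\mathbb R^M$, and $\Sigma_0\in\mathbb R^{M\times M}$ symmetric positive definite. For $b>0$, $c\in\mathbb R$, the Pólya-Gamma distribution $\mathrm{PG}(b,c)$ is the law of $\frac1{2\pi^2}\sum_{r\ge1}\frac{\gamma_r}{(r-1/2)^2+c^2/(4\pi^2)}$ with $\gamma_r$ i.i.d. $\mathrm{Gamma}(b,1)$. The augmented IB-Logit model has unknowns $B=(\beta_1,\dots,\beta_K)\in\mathbb R^{M\times K}$ and $\Omega=(\omega_1,\dots,\omega_K)\in\mathbb R^{N\times K}$: the $\beta_k$ are i.i.d. $\mathcal N(\mu_0,\Sigma_0)$, and, given $B$, all the variables $y_{ik}$ and $\omega_{ik}$ are independent with $$y_{ik}\sim\mathrm{Bernoulli}\Big(\frac{e^{x_i^\top\beta_k}}{1+e^{x_i^\top\beta_k}}\Big),\qquad \omega_{ik}\sim\mathrm{PG}(1,x_i^\top\beta_k).$$ The variational law is $$q(B,\Omega)=\prod_{k=1}^K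 q(\beta_k,\omega_k),\qquad q(\beta_k,\omega_k)=\mathcal N(\beta_k;\tilde\mu_k,\tilde\Sigma_k)\prod_{i=1}^N\mathrm{PG}(\omega_{ik};1,\tilde c_{ik}),$$ where $\tilde\mu_k\in\mathbb R^M$ and the symmetric positive definite matrices $\tilde\Sigma_k$ are arbitrary and $\tilde c_{ik}=\big(x_i^\top\tilde\Sigma_kx_i+(x_i^\top\tilde\mu_k)^2\big)^{1/2}$. Let $$\mathrm{ELBO}[q(B,\Omega)]=\mathbb E_q[\log p(Y,B,\Omega)]-\mathbb E_q[\log q(B,\Omega)],$$ with densities taken with respect to Lebesgue measure in $(B,\Omega)$, and let $\mathrm{ELBO}[q(\beta_k,\omega_k)]$ be the corresponding quantity for the model of the $k$-th category alone, with responses $y_k=(y_{1k},\dots,y_{Nk})$ and unknowns $(\beta_k,\omega_k)$. **Proposition.** All these densities exist, all these expectations are finite, and $$\mathrm{ELBO}[q(B,\Omega)]=\sum_{k=1}^K\mathrm{ELBO}[q(\beta_k,\omega_k)],$$ where, for each $k$, $$\begin{aligned}\mathrm{ELBO}[q(\beta_k,\omega_k)]={}&\tfrac12M+\tfrac12\log\det\tilde\Sigma_k+\tfrac12\log\det\Sigma_0^{-1}-\tfrac12(\tilde\mu_k-\mu_0)^\top\Sigma_0^{-1}(\tilde\mu_k-\mu_0)-\tfrac12\operatorname{tr}(\Sigma_0^{-1}\tilde\Sigma_k)\\&+\sum_{i=1}^N\Big[(y_{ik}-\tfrac12)\,x_i^\top\tilde\mu_k-\log\big(1+e^{-\tilde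 c_{ik}}\big)-\tfrac12\tilde c_{ik}\Big].\end{aligned}$$ The first line equals $-\mathrm{KL}\big(\mathcal N(\tilde\mu_k,\tilde\Sigma_k)\,\|\,\mathcal N(\mu_0,\Sigma_0)\big)$, which is finite. -/

import Mathlib

open MeasureTheory ProbabilityTheory InformationTheory Matrix

noncomputable section

namespace IBLogit

/-- The series `(1 / (2π²)) ∑_{r ≥ 1} γ_r / ((r - 1/2)² + c² / (4π²))`, with the index shifted so
that it starts at `r = 0`. -/
def polyaGammaSeries (c : ℝ) (γ : ℕ → ℝ) : ℝ :=
  1 / (2 * Real.pi ^ 2) *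
    ∑' r : ℕ, γ r / (((r : ℝ) + 1 / 2) ^ 2 + c ^ 2 / (4 * Real.pi ^ 2))

/-- The Pólya-Gamma distribution `PG(b, c)`, for `b > 0`: the law of the series above when the
`γ_r` are independent `Gamma(b, 1)` random variables. -/
def polyaGamma (b c : ℝ) : Measure ℝ :=
  (Measure.infinitePi fun _ : ℕ => gammaMeasure b 1).map (polyaGammaSeries c)

/-- The linear predictor `xᵀ β`. -/
def linPred {M : ℕ} (x : Fin M → ℝ) (β : EuclideanSpace ℝ (Fin M)) : ℝ :=
  ∑ m, x m * β m

/-- The Bernoulli mass `p(y | η)` with success probability `exp η / (1 + exp η)`. -/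
def bernoulliLogitMass (y : Bool) (η : ℝ) : ℝ :=
  if y then Real.exp η / (1 + Real.exp η) else 1 - Real.exp η / (1 + Real.exp η)

/-! ### One category: Bayesian logistic regression with Pólya-Gamma augmentation -/

/-- The law of `(β_k, ω_k)`: `β_k ∼ N(μ₀, Σ₀)` and, given `β_k`, the `ω_{ik}` are independent with
`ω_{ik} ∼ PG(1, x_iᵀ β_k)`. -/
def latentLawOne {N M : ℕ} (X : Matrix (Fin N) (Fin M) ℝ)
    (μ₀ : EuclideanSpace ℝ (Fin M)) (S₀ : Matrix (Fin M) (Fin M) ℝ) :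
    Measure (EuclideanSpace ℝ (Fin M) × (Fin N → ℝ)) :=
  (multivariateGaussian μ₀ S₀).bind fun β =>
    (Measure.dirac β).prod (Measure.pi fun i => polyaGamma 1 (linPred (X i) β))

/-- The (sub-probability) measure `p(y_k, dβ_k, dω_k)` of the augmented model at the observed
responses `y_k`; given `β_k`, the responses are independent of each other and of `ω_k`. -/
def jointLawOne {N M : ℕ} (X : Matrix (Fin N) (Fin M) ℝ)
    (μ₀ : EuclideanSpace ℝ (Fin M)) (S₀ : Matrix (Fin M) (Fin M) ℝ) (y : Fin N → Bool) :
    Measure (EuclideanSpace ℝ (Fin M) × (Fin N → ℝ)) :=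
  (latentLawOne X μ₀ S₀).withDensity fun z =>
    ENNReal.ofReal (∏ i, bernoulliLogitMass (y i) (linPred (X i) z.1))

/-- `q(β_k, ω_k) = N(β_k; μ̃_k, Σ̃_k) ∏_i PG(ω_{ik}; 1, c̃_{ik})`. -/
def variationalLawOne {N M : ℕ} (μ : EuclideanSpace ℝ (Fin M)) (S : Matrix (Fin M) (Fin M) ℝ)
    (c : Fin N → ℝ) : Measure (EuclideanSpace ℝ (Fin M) × (Fin N → ℝ)) :=
  (multivariateGaussian μ S).prod (Measure.pi fun i => polyaGamma 1 (c i))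

/-! ### All categories. A matrix `B` or `Ω` is given by its columns `β_k` or `ω_k`. -/

/-- The law of `(B, Ω)`: the columns `β_k` of `B` are i.i.d. `N(μ₀, Σ₀)` and, given `B`, the
`ω_{ik}` are independent with `ω_{ik} ∼ PG(1, x_iᵀ β_k)`. -/
def latentLaw {N M : ℕ} (K : ℕ) (X : Matrix (Fin N) (Fin M) ℝ)
    (μ₀ : EuclideanSpace ℝ (Fin M)) (S₀ : Matrix (Fin M) (Fin M) ℝ) :
    Measure ((Fin K → EuclideanSpace ℝ (Fin M)) × (Fin K → Fin N → ℝ)) :=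
  (Measure.pi fun _ : Fin K => multivariateGaussian μ₀ S₀).bind fun B =>
    (Measure.dirac B).prod
      (Measure.pi fun k => Measure.pi fun i => polyaGamma 1 (linPred (X i) (B k)))

/-- The measure `p(Y, dB, dΩ)` of the augmented IB-Logit model at the observed responses `Y`. -/
def jointLaw {N M K : ℕ} (X : Matrix (Fin N) (Fin M) ℝ)
    (μ₀ : EuclideanSpace ℝ (Fin M)) (S₀ : Matrix (Fin M) (Fin M) ℝ)
    (Y : Fin N → Fin K → Bool) :
    Measure ((Fin K → EuclideanSpace ℝ (Fin M)) × (Fin K → Fin N → ℝ)) :=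
  (latentLaw K X μ₀ S₀).withDensity fun z =>
    ENNReal.ofReal (∏ k, ∏ i, bernoulliLogitMass (Y i k) (linPred (X i) (z.1 k)))

/-- `q(B, Ω) = ∏_k [N(β_k; μ̃_k, Σ̃_k) ∏_i PG(ω_{ik}; 1, c̃_{ik})]`. -/
def variationalLaw {N M K : ℕ} (μ : Fin K → EuclideanSpace ℝ (Fin M))
    (S : Fin K → Matrix (Fin M) (Fin M) ℝ) (c : Fin N → Fin K → ℝ) :
    Measure ((Fin K → EuclideanSpace ℝ (Fin M)) × (Fin K → Fin N → ℝ)) :=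
  (Measure.pi fun k => multivariateGaussian (μ k) (S k)).prod
    (Measure.pi fun k => Measure.pi fun i => polyaGamma 1 (c i k))

/-! ### The evidence lower bound -/

/-- The logarithm of the Lebesgue density of `P`. -/
def logDensity {Z : Type*} [MeasureSpace Z] (P : Measure Z) (z : Z) : ℝ :=
  Real.log (P.rnDeriv volume z).toReal

/-- The evidence lower bound `E_q[log p(y, z)] - E_q[log q(z)]`, where `P` is the measure with
density `z ↦ p(y, z)` at the observed `y` and `Q` is the variational law. -/
def elbo {Z : Type*} [MeasureSpace Z] (P Q : Measure Z) : ℝ :=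
  ∫ z, logDensity P z ∂Q - ∫ z, logDensity Q z ∂Q

/-- No convention about undefined densities, `log 0` or divergent integrals enters `elbo P Q`:
both measures have a Lebesgue density, `p(y, z) > 0` for `Q`-almost every `z`, and both
expectations are finite. -/
def ElboWellDefined {Z : Type*} [MeasureSpace Z] (P Q : Measure Z) : Prop :=
  P ≪ volume ∧ Q ≪ volume ∧ Q ≪ P ∧ Integrable (logDensity P) Q ∧ Integrable (logDensity Q) Q

end IBLogit

end

noncomputable section

namespace IBLogit

open Filter Topology
open scoped ENNReal

/-! ### The standard exponential law and weighted sums of independent copies -/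

/-! The heart is that `PG(1, c)` is an exponential tilt of one fixed law: it has density `cosh(c/2)
exp(-c²x/2)` with respect to `PG(1, 0)` (`polyaGamma_one_eq_withDensity`). In the defining series
the parameter only shifts every exponential rate by `c²/2`, and the normalising constant is the
Euler product of `cosh`. Hence all the laws `PG(1, c)` share one base density, and `log p(ω | c) =
log cosh(c/2) - c²ω/2 + log base(ω)`.

In the joint log density the Bernoulli term `log p(y | η)` and `log cosh(η/2)` add up to `(y - 1/2)η
- log 2` (`log_bernoulliLogitMass_add`), so only terms linear and quadratic in `β` remain. Under `q`
the variables `β` and `ω` are independent and `E(xᵀβ)² = c̃²`. The quadratic term therefore cancels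
the tilt of `q`, whatever the mean of `ω` is, and the `log base` terms cancel as well. What is left
is `-log 2 - log cosh(c̃/2)`, the linear term, and a Gaussian part that is minus a Kullback-Leibler
divergence (`elbo_one_eq`).

Cancelling `log base` requires that it be integrable. The law has a bounded density, because one
summand is exponential and convolution preserves the bound, and it has a finite mean; these two
facts give a finite entropy (`integrable_mul_log_of_bounded`).

Both `p` and `q` factor over the categories, so their logarithms are sums of functions of single
pairs `(β_k, ω_k)`, and the bound is additive (`integral_log_prod_category`). -/

instance isProbabilityMeasure_gammaMeasure_one : IsProbabilityMeasure (gammaMeasure 1 1) :=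
  isProbabilityMeasure_gammaMeasure one_pos one_pos

theorem gammaMeasure_one_one_eq :
    gammaMeasure 1 1 =
      (volume.restrict (Set.Ioi 0)).withDensity fun x : ℝ => ENNReal.ofReal (Real.exp (-x)) := by
  rw [gammaMeasure, Measure.restrict_congr_set Ioi_ae_eq_Ici, ← withDensity_indicator measurableSet_Ici]
  congr 1
  ext x
  by_cases hx : 0 ≤ x
  · rw [gammaPDF_of_nonneg hx, Set.indicator_of_mem (Set.mem_Ici.2 hx)]
    simp
  · rw [gammaPDF_of_neg (not_le.1 hx), Set.indicator_of_notMem (by simpa using hx)]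

theorem ae_nonneg_gammaMeasure_one : ∀ᵐ x ∂gammaMeasure 1 1, 0 ≤ x := by
  rw [gammaMeasure_one_one_eq]
  refine (withDensity_absolutelyContinuous _ _).ae_le ?_
  filter_upwards [ae_restrict_mem measurableSet_Ioi] with x hx using le_of_lt hx

theorem gammaMeasure_one_one_le (A : Set ℝ) : gammaMeasure 1 1 A ≤ volume A := by
  have h : gammaMeasure 1 1 ≤ (volume : Measure ℝ) := by
    rw [gammaMeasure_one_one_eq]
    calc _ ≤ (volume.restrict (Set.Ioi 0)).withDensity (fun _ : ℝ => 1) := by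
          refine withDensity_mono ?_
          filter_upwards [ae_restrict_mem measurableSet_Ioi] with x hx
          simp [le_of_lt (Set.mem_Ioi.1 hx)]
      _ = volume.restrict (Set.Ioi 0) := by simp
      _ ≤ volume := Measure.restrict_le_self
  exact h A

theorem lintegral_ofReal_gammaMeasure_one_ne_top :
    ∫⁻ x, ENNReal.ofReal x ∂gammaMeasure 1 1 ≠ ⊤ := by
  rw [gammaMeasure_one_one_eq, lintegral_withDensity_eq_lintegral_mul _ (by fun_prop) (by fun_prop)]
  have h := (Real.GammaIntegral_convergent (s := 2) (by norm_num)).lintegral_lt_top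
  refine ne_of_lt (lt_of_le_of_lt (le_of_eq ?_) h)
  refine lintegral_congr fun x => ?_
  rw [Pi.mul_apply, ← ENNReal.ofReal_mul (Real.exp_pos _).le]
  norm_num

theorem integral_cexp_gammaMeasure_one {z : ℂ} (hz : z.re < 1) :
    ∫ x, Complex.exp (z * x) ∂gammaMeasure 1 1 = 1 / (1 - z) := by
  have h : ∀ x : ℝ, (Real.exp (-x)) • Complex.exp (z * x) = Complex.exp ((z - 1) * x) := by
    intro x
    rw [Complex.real_smul, Complex.ofReal_exp, ← Complex.exp_add]
    congr 1; push_cast; ring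
  rw [gammaMeasure_one_one_eq, integral_withDensity_eq_integral_toReal_smul (by fun_prop) (by simp)]
  simp_rw [ENNReal.toReal_ofReal (Real.exp_pos _).le, h]
  rw [integral_exp_mul_complex_Ioi (by simpa using hz)]
  have : z - 1 ≠ 0 := fun h => by simp [sub_eq_zero.1 h] at hz
  have h2 : 1 - z ≠ 0 := fun h => this (by linear_combination -h)
  simp
  field_simp
  ring

/-- The law of `∑ aᵣ γᵣ` for independent standard exponential `γᵣ`. -/
def weightedExpLaw (a : ℕ → ℝ) : Measure ℝ :=
  (Measure.infinitePi fun _ : ℕ => gammaMeasure 1 1).map fun γ => ∑' r, a r * γ r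

theorem measurable_weightedSum (a : ℕ → ℝ) : Measurable fun γ : ℕ → ℝ => ∑' r, a r * γ r := by
  fun_prop

instance (a : ℕ → ℝ) : IsProbabilityMeasure (weightedExpLaw a) :=
  Measure.isProbabilityMeasure_map (measurable_weightedSum a).aemeasurable

theorem ae_nonneg_infinitePi :
    ∀ᵐ γ ∂(Measure.infinitePi fun _ : ℕ => gammaMeasure 1 1), ∀ r, 0 ≤ γ r :=
  ae_all_iff.2 fun r =>
    (measurePreserving_eval_infinitePi (fun _ : ℕ => gammaMeasure 1 1) r).quasiMeasurePreserving.ae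
      ae_nonneg_gammaMeasure_one

/-- By Tonelli the expectation is `∑ aᵣ` times the mean of one exponential. This single estimate
gives both the almost sure convergence of the series and its finite first moment. -/
theorem lintegral_tsum_ne_top {a : ℕ → ℝ} (ha : ∀ r, 0 ≤ a r) (hs : Summable a) :
    ∫⁻ γ, ∑' r, ENNReal.ofReal (a r * γ r) ∂(Measure.infinitePi fun _ : ℕ => gammaMeasure 1 1)
      ≠ ⊤ := by
  rw [lintegral_tsum fun r => Measurable.aemeasurable (by fun_prop)]
  have h : ∀ r, ∫⁻ γ, ENNReal.ofReal (a r * γ r)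
      ∂(Measure.infinitePi fun _ : ℕ => gammaMeasure 1 1) =
      ENNReal.ofReal (a r) * ∫⁻ x, ENNReal.ofReal x ∂gammaMeasure 1 1 := by
    intro r
    rw [← lintegral_const_mul _ (by fun_prop),
      ← (measurePreserving_eval_infinitePi (fun _ : ℕ => gammaMeasure 1 1) r).lintegral_comp
        (by fun_prop)]
    simp_rw [ENNReal.ofReal_mul (ha r)]
  simp_rw [h]
  rw [ENNReal.tsum_mul_right]
  exact ENNReal.mul_ne_top hs.tsum_ofReal_ne_top lintegral_ofReal_gammaMeasure_one_ne_top

theorem ae_summable_weightedSum {a : ℕ → ℝ} (ha : ∀ r, 0 ≤ a r) (hs : Summable a) :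
    ∀ᵐ γ ∂(Measure.infinitePi fun _ : ℕ => gammaMeasure 1 1), Summable fun r => a r * γ r := by
  filter_upwards [ae_lt_top' (Measurable.aemeasurable (by fun_prop)) (lintegral_tsum_ne_top ha hs), ae_nonneg_infinitePi]
    with γ h h0
  have := ENNReal.summable_toReal h.ne
  simpa only [ENNReal.toReal_ofReal (mul_nonneg (ha _) (h0 _))] using this

theorem ae_nonneg_weightedExpLaw {a : ℕ → ℝ} (ha : ∀ r, 0 ≤ a r) :
    ∀ᵐ x ∂weightedExpLaw a, 0 ≤ x := by
  rw [weightedExpLaw, ae_map_iff (measurable_weightedSum a).aemeasurable measurableSet_Ici]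
  filter_upwards [ae_nonneg_infinitePi] with γ h0
  -- Summability plays no role here: a divergent `tsum` has the value `0`, which is nonnegative too.
  exact tsum_nonneg fun r => mul_nonneg (ha r) (h0 r)

theorem integrable_id_weightedExpLaw {a : ℕ → ℝ} (ha : ∀ r, 0 ≤ a r) (hs : Summable a) :
    Integrable (fun x => x) (weightedExpLaw a) := by
  refine ⟨by fun_prop, ?_⟩
  rw [hasFiniteIntegral_iff_ofReal (ae_nonneg_weightedExpLaw ha), weightedExpLaw,
    lintegral_map (by fun_prop) (measurable_weightedSum a)]
  refine lt_of_le_of_lt (le_of_eq (lintegral_congr_ae ?_)) (lintegral_tsum_ne_top ha hs).lt_top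
  filter_upwards [ae_summable_weightedSum ha hs, ae_nonneg_infinitePi] with γ h h0
  exact ENNReal.ofReal_tsum_of_nonneg (fun r => mul_nonneg (ha r) (h0 r)) h

/-- Independence computes the transform of each partial sum, and dominated convergence passes to the
limit, since `|exp(z s)| ≤ 1` for `Re z ≤ 0` and `s ≥ 0`. The half plane, rather than the imaginary
axis alone, is what the tilting argument needs. With partial products, later identities can be
proved factor by factor. -/
theorem tendsto_prod_integral_cexp {a : ℕ → ℝ} (ha : ∀ r, 0 ≤ a r) (hs : Summable a) {z : ℂ}
    (hz : z.re ≤ 0) :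
    Tendsto (fun n => ∏ r ∈ Finset.range n, 1 / (1 - z * a r)) atTop
      (𝓝 (∫ x, Complex.exp (z * x) ∂weightedExpLaw a)) := by
  have hI : iIndepFun (fun (r : ℕ) (γ : ℕ → ℝ) => Complex.exp (z * a r * γ r))
      (Measure.infinitePi fun _ : ℕ => gammaMeasure 1 1) :=
    iIndepFun_infinitePi (P := fun _ : ℕ => gammaMeasure 1 1)
      (X := fun r x => Complex.exp (z * a r * x)) (fun r => by fun_prop)
  have hprod : ∀ n, ∏ r ∈ Finset.range n, 1 / (1 - z * a r) =
      ∫ γ, Complex.exp (z * ((∑ r ∈ Finset.range n, a r * γ r : ℝ) : ℂ))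
        ∂(Measure.infinitePi fun _ : ℕ => gammaMeasure 1 1) := by
    intro n
    have h1 := (hI.precomp (g := ((↑) : Fin n → ℕ)) Fin.val_injective).integral_fun_prod_eq_prod_integral
      (fun i => Measurable.aestronglyMeasurable (by fun_prop))
    rw [Finset.prod_range]
    have h2 : ∀ i : Fin n, ∫ γ, Complex.exp (z * a i * γ i)
        ∂(Measure.infinitePi fun _ : ℕ => gammaMeasure 1 1) = 1 / (1 - z * a i) := by
      intro i
      rw [← integral_cexp_gammaMeasure_one (z := z * a i)]
      · have h := integral_map (μ := Measure.infinitePi fun _ : ℕ => gammaMeasure 1 1)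
          (φ := fun γ : ℕ → ℝ => γ i) (measurable_pi_apply _).aemeasurable
          (f := fun x : ℝ => Complex.exp (z * a i * x)) (by fun_prop)
        rw [Measure.infinitePi_map_eval (fun _ : ℕ => gammaMeasure 1 1)] at h
        exact h.symm
      · rw [Complex.re_mul_ofReal]
        nlinarith [ha i]
    simp only [h2] at h1
    rw [← h1]
    refine integral_congr_ae (ae_of_all _ fun γ => ?_)
    simp only
    rw [← Complex.exp_sum, Finset.sum_range]
    push_cast
    rw [Finset.mul_sum]
    congr 1
    exact Finset.sum_congr rfl fun i _ => by ring
  simp_rw [hprod]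
  rw [weightedExpLaw, integral_map (measurable_weightedSum a).aemeasurable (by fun_prop)]
  refine tendsto_integral_of_dominated_convergence (fun _ => 1)
    (fun n => Measurable.aestronglyMeasurable (by fun_prop))
    (integrable_const _) (fun n => ?_) ?_
  · filter_upwards [ae_nonneg_infinitePi] with γ h0
    rw [Complex.norm_exp, Complex.re_mul_ofReal, Real.exp_le_one_iff]
    exact mul_nonpos_of_nonpos_of_nonneg hz
      (Finset.sum_nonneg fun r _ => mul_nonneg (ha r) (h0 r))
  · filter_upwards [ae_summable_weightedSum ha hs] with γ h
    have := h.hasSum.tendsto_sum_nat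
    refine (Continuous.tendsto (f := fun x : ℝ => Complex.exp (z * x)) (by fun_prop) _).comp this

/-- The first summand is independent of the others; on characteristic functions this amounts to
splitting one factor off the partial products. -/
theorem weightedExpLaw_eq_conv {a : ℕ → ℝ} (ha : ∀ r, 0 ≤ a r) (hs : Summable a) :
    weightedExpLaw a =
      ((gammaMeasure 1 1).map fun x => a 0 * x) ∗ (weightedExpLaw fun r => a (r + 1)) := by
  have : IsProbabilityMeasure ((gammaMeasure 1 1).map fun x => a 0 * x) :=
    Measure.isProbabilityMeasure_map (by fun_prop)
  refine Measure.ext_of_charFun (funext fun t => ?_)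
  rw [charFun_conv]
  have hz : ((t : ℂ) * Complex.I).re ≤ 0 := by simp
  have hc : ∀ ν : Measure ℝ, charFun ν t = ∫ x, Complex.exp (t * Complex.I * x) ∂ν := by
    intro ν
    rw [charFun_apply_real]
    refine integral_congr_ae (ae_of_all _ fun x => ?_)
    simp only
    congr 1; ring
  have h0 : charFun ((gammaMeasure 1 1).map fun x => a 0 * x) t =
      1 / (1 - t * Complex.I * a 0) := by
    rw [hc, integral_map (by fun_prop) (by fun_prop),
      ← integral_cexp_gammaMeasure_one (z := t * Complex.I * a 0) (by simp)]
    refine integral_congr_ae (ae_of_all _ fun x => ?_)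
    simp only
    push_cast; congr 1; ring
  rw [h0]
  rw [hc, hc]
  have h1 := (tendsto_prod_integral_cexp ha hs hz).comp (tendsto_add_atTop_nat 1)
  have h2 := (tendsto_prod_integral_cexp (a := fun r => a (r + 1)) (fun r => ha _)
    ((summable_nat_add_iff 1).2 hs) hz).const_mul (1 / (1 - t * Complex.I * a 0))
  refine tendsto_nhds_unique h1 (h2.congr fun n => ?_)
  simp only [Function.comp]
  rw [Finset.prod_range_succ']
  ring

/-- The first summand `a₀γ₀` has a density at most `1/a₀`, and convolution with a probability
measure keeps this bound. It yields absolute continuity and a bounded density at once. -/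
theorem weightedExpLaw_le {a : ℕ → ℝ} (ha : ∀ r, 0 ≤ a r) (hs : Summable a) (h0 : 0 < a 0) :
    weightedExpLaw a ≤ ENNReal.ofReal (a 0)⁻¹ • (volume : Measure ℝ) := by
  rw [weightedExpLaw_eq_conv ha hs]
  have : IsProbabilityMeasure ((gammaMeasure 1 1).map fun x => a 0 * x) :=
    Measure.isProbabilityMeasure_map (by fun_prop)
  set ρ := weightedExpLaw fun r => a (r + 1)
  refine Measure.le_iff.2 fun A hA => ?_
  rw [Measure.conv_comm, Measure.conv, Measure.map_apply (by fun_prop) hA,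
    Measure.prod_apply (measurable_add hA)]
  calc ∫⁻ y, ((gammaMeasure 1 1).map fun x => a 0 * x)
        (Prod.mk y ⁻¹' ((fun p : ℝ × ℝ => p.1 + p.2) ⁻¹' A)) ∂ρ
      ≤ ∫⁻ _, ENNReal.ofReal (a 0)⁻¹ * volume A ∂ρ := by
        refine lintegral_mono fun y => ?_
        rw [Measure.map_apply (by fun_prop) (measurable_prodMk_left (measurable_add hA))]
        refine (gammaMeasure_one_one_le _).trans ?_
        have : (fun x => a 0 * x) ⁻¹' (Prod.mk y ⁻¹' ((fun p : ℝ × ℝ => p.1 + p.2) ⁻¹' A)) =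
            (fun x => a 0 * x) ⁻¹' ((fun x => y + x) ⁻¹' A) := rfl
        rw [this, Real.volume_preimage_mul_left h0.ne', measure_preimage_add,
          abs_of_pos (inv_pos.2 h0)]
    _ = (ENNReal.ofReal (a 0)⁻¹ • (volume : Measure ℝ)) A := by simp

/-! ### The Pólya-Gamma laws `PG(1, c)` -/

/-- The rate of the `r`-th exponential summand of `PG(1, c)`. -/
def polyaGammaRate (c : ℝ) (r : ℕ) : ℝ :=
  2 * Real.pi ^ 2 * ((r : ℝ) + 1 / 2) ^ 2 + c ^ 2 / 2

theorem polyaGammaRate_pos (c : ℝ) (r : ℕ) : 0 < polyaGammaRate c r := by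
  unfold polyaGammaRate; positivity

/-- A common shift of all the rates corresponds to an exponential tilt of the sum; this is why the
laws `PG(1, c)` form an exponential family in `-c²/2`. -/
theorem polyaGammaRate_eq_add (c : ℝ) (r : ℕ) :
    polyaGammaRate c r = polyaGammaRate 0 r + c ^ 2 / 2 := by
  unfold polyaGammaRate; ring

theorem inv_polyaGammaRate_nonneg (c : ℝ) (r : ℕ) : 0 ≤ (polyaGammaRate c r)⁻¹ :=
  (inv_pos.2 (polyaGammaRate_pos c r)).le

theorem summable_inv_polyaGammaRate (c : ℝ) : Summable fun r => (polyaGammaRate c r)⁻¹ := by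
  have h : Summable fun r : ℕ => (((r + 1 : ℕ) : ℝ) ^ 2)⁻¹ :=
    (summable_nat_add_iff 1).2 (Real.summable_nat_pow_inv.2 one_lt_two)
  refine h.of_nonneg_of_le (inv_polyaGammaRate_nonneg c) fun r => ?_
  refine inv_anti₀ (by positivity) ?_
  unfold polyaGammaRate
  have h3 := Real.pi_gt_three
  have hr : (0 : ℝ) ≤ r := r.cast_nonneg
  have hp : (9 : ℝ) ≤ Real.pi ^ 2 := by nlinarith
  have : 18 * ((r : ℝ) + 1 / 2) ^ 2 ≤ 2 * Real.pi ^ 2 * ((r : ℝ) + 1 / 2) ^ 2 := by gcongr; linarith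
  push_cast
  nlinarith [sq_nonneg c]

theorem polyaGamma_one_eq (c : ℝ) :
    polyaGamma 1 c = weightedExpLaw fun r => (polyaGammaRate c r)⁻¹ := by
  unfold polyaGamma weightedExpLaw
  congr 1
  ext γ
  rw [polyaGammaSeries, ← tsum_mul_left]
  refine tsum_congr fun r => ?_
  have : (0 : ℝ) < ((r : ℝ) + 1 / 2) ^ 2 + c ^ 2 / (4 * Real.pi ^ 2) := by positivity
  have h2 : polyaGammaRate c r =
      2 * Real.pi ^ 2 * (((r : ℝ) + 1 / 2) ^ 2 + c ^ 2 / (4 * Real.pi ^ 2)) := by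
    unfold polyaGammaRate; field_simp; ring
  simp only [h2]
  field_simp

instance isProbabilityMeasure_polyaGamma_one (c : ℝ) : IsProbabilityMeasure (polyaGamma 1 c) := by
  rw [polyaGamma_one_eq]; infer_instance

theorem ae_nonneg_polyaGamma_one (c : ℝ) : ∀ᵐ x ∂polyaGamma 1 c, 0 ≤ x := by
  rw [polyaGamma_one_eq]; exact ae_nonneg_weightedExpLaw (inv_polyaGammaRate_nonneg c)

theorem integrable_id_polyaGamma_one (c : ℝ) : Integrable (fun x => x) (polyaGamma 1 c) := by
  rw [polyaGamma_one_eq]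
  exact integrable_id_weightedExpLaw (inv_polyaGammaRate_nonneg c) (summable_inv_polyaGammaRate c)

theorem polyaGamma_one_le (c : ℝ) :
    polyaGamma 1 c ≤ ENNReal.ofReal (polyaGammaRate c 0) • (volume : Measure ℝ) := by
  rw [polyaGamma_one_eq]
  simpa using weightedExpLaw_le (inv_polyaGammaRate_nonneg c) (summable_inv_polyaGammaRate c)
    (inv_pos.2 (polyaGammaRate_pos c 0))

/-- Euler's product for `sinh`. -/
theorem tendsto_euler_sinh_prod (x : ℝ) :
    Tendsto (fun n : ℕ => Real.pi * x * ∏ j ∈ Finset.range n, (1 + x ^ 2 / ((j : ℝ) + 1) ^ 2))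
      atTop (𝓝 (Real.sinh (Real.pi * x))) := by
  -- Euler's product for the sine is evaluated at `ix`, multiplied by `-i`, and reduced to its real
  -- part.
  have h := (Complex.tendsto_euler_sin_prod (x * Complex.I)).mul_const (-Complex.I)
  have h2 := (Complex.continuous_re.tendsto _).comp h
  have e : (Complex.sin (Real.pi * (x * Complex.I)) * -Complex.I).re =
      Real.sinh (Real.pi * x) := by
    rw [← mul_assoc, Complex.sin_mul_I, ← Complex.ofReal_mul, ← Complex.ofReal_sinh]
    rw [show ((Real.sinh (Real.pi * x) : ℂ) * Complex.I * -Complex.I) =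
      (Real.sinh (Real.pi * x) : ℂ) by linear_combination -(Real.sinh (Real.pi * x) : ℂ) * Complex.I_sq]
    exact Complex.ofReal_re _
  rw [e] at h2
  refine h2.congr fun n => ?_
  have hp : ∏ j ∈ Finset.range n, ((1 : ℂ) - (x * Complex.I) ^ 2 / ((j : ℂ) + 1) ^ 2) =
      ((∏ j ∈ Finset.range n, (1 + x ^ 2 / ((j : ℝ) + 1) ^ 2) : ℝ) : ℂ) := by
    push_cast
    refine Finset.prod_congr rfl fun j _ => ?_
    rw [mul_pow, Complex.I_sq]; ring
  simp only [Function.comp, hp]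
  rw [← Complex.ofReal_re (Real.pi * x * _)]
  congr 1
  push_cast
  linear_combination -(Real.pi * x * ∏ j ∈ Finset.range n, (1 + (x : ℂ) ^ 2 / ((j : ℂ) + 1) ^ 2)) *
    Complex.I_sq

theorem prod_range_two_mul {α : Type*} [CommMonoid α] (f : ℕ → α) (n : ℕ) :
    ∏ j ∈ Finset.range (2 * n), f j =
      (∏ r ∈ Finset.range n, f (2 * r)) * ∏ r ∈ Finset.range n, f (2 * r + 1) := by
  induction n with
  | zero => simp
  | succ n ih =>
    rw [Nat.mul_succ, Finset.prod_range_succ, Finset.prod_range_succ, ih, Finset.prod_range_succ,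
      Finset.prod_range_succ]
    ac_rfl

/-- This rests on `cosh(c/2) = sinh c / (2 sinh(c/2))`. In the product for `sinh c`, the factors
with an even denominator root `2(r+1)` rebuild the product for `sinh(c/2)`, and those with an odd
root `2r+1` are exactly the rate ratios. -/
theorem tendsto_prod_polyaGammaRate (c : ℝ) :
    Tendsto (fun n => ∏ r ∈ Finset.range n, (polyaGammaRate c r / polyaGammaRate 0 r)) atTop
      (𝓝 (Real.cosh (c / 2))) := by
  rcases eq_or_ne c 0 with rfl | hc
  · have : ∀ r, polyaGammaRate 0 r / polyaGammaRate 0 r = 1 := fun r =>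
      div_self (polyaGammaRate_pos 0 r).ne'
    simp [this]
  have hpi := Real.pi_pos.ne'
  have hs : Real.sinh (c / 2) ≠ 0 := by simpa using hc
  have h1 := tendsto_euler_sinh_prod (c / (2 * Real.pi))
  -- Only the partial products of even length `2n` are used, so that the splitting by parity is
  -- exact.
  have h2 := (tendsto_euler_sinh_prod (c / Real.pi)).comp
    (tendsto_id.const_mul_atTop' (show 0 < 2 by norm_num))
  rw [show Real.pi * (c / (2 * Real.pi)) = c / 2 by field_simp] at h1
  rw [show Real.pi * (c / Real.pi) = 2 * (c / 2) by field_simp, Real.sinh_two_mul] at h2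
  have h3 := (h2.div h1 hs).div_const 2
  rw [show 2 * Real.sinh (c / 2) * Real.cosh (c / 2) / Real.sinh (c / 2) / 2 = Real.cosh (c / 2) by
    field_simp] at h3
  refine h3.congr fun n => ?_
  simp only [Pi.div_apply, Function.comp, id]
  rw [prod_range_two_mul]
  have hA : ∏ r ∈ Finset.range n, (1 + (c / Real.pi) ^ 2 / (((2 * r + 1 : ℕ) : ℝ) + 1) ^ 2) =
      ∏ r ∈ Finset.range n, (1 + (c / (2 * Real.pi)) ^ 2 / ((r : ℝ) + 1) ^ 2) := by
    refine Finset.prod_congr rfl fun r _ => ?_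
    have : (r : ℝ) + 1 ≠ 0 := by positivity
    push_cast
    rw [show 2 * (r : ℝ) + 1 + 1 = 2 * (r + 1) by ring]
    field_simp
  have hB : ∏ r ∈ Finset.range n, (1 + (c / Real.pi) ^ 2 / (((2 * r : ℕ) : ℝ) + 1) ^ 2) =
      ∏ r ∈ Finset.range n, (polyaGammaRate c r / polyaGammaRate 0 r) := by
    refine Finset.prod_congr rfl fun r _ => ?_
    have : 2 * (r : ℝ) + 1 ≠ 0 := by positivity
    unfold polyaGammaRate
    push_cast
    rw [show (r : ℝ) + 1 / 2 = (2 * r + 1) / 2 by ring]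
    field_simp
    ring
  rw [hA, hB]
  have : 0 < ∏ r ∈ Finset.range n, (1 + (c / (2 * Real.pi)) ^ 2 / ((r : ℝ) + 1) ^ 2) :=
    Finset.prod_pos fun r _ => by positivity
  generalize ∏ r ∈ Finset.range n, (1 + (c / (2 * Real.pi)) ^ 2 / ((r : ℝ) + 1) ^ 2) = A at *
  field_simp

/-- The Radon-Nikodym derivative of `PG(1, c)` with respect to `PG(1, 0)`. -/
def polyaGammaTilt (c x : ℝ) : ℝ :=
  Real.cosh (c / 2) * Real.exp (-(c ^ 2 / 2 * x))

theorem polyaGammaTilt_pos (c x : ℝ) : 0 < polyaGammaTilt c x :=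
  mul_pos (Real.cosh_pos _) (Real.exp_pos _)

theorem polyaGammaTilt_le (c : ℝ) {x : ℝ} (hx : 0 ≤ x) : polyaGammaTilt c x ≤ Real.cosh (c / 2) := by
  refine mul_le_of_le_one_right (Real.cosh_pos _).le (Real.exp_le_one_iff.2 ?_)
  have : 0 ≤ c ^ 2 / 2 * x := by positivity
  linarith

@[fun_prop]
theorem measurable_polyaGammaTilt_uncurry : Measurable fun p : ℝ × ℝ => polyaGammaTilt p.1 p.2 := by
  unfold polyaGammaTilt
  have : Measurable Real.cosh := Real.continuous_cosh.measurable
  fun_prop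

@[fun_prop]
theorem measurable_polyaGammaTilt (c : ℝ) : Measurable (polyaGammaTilt c) :=
  measurable_polyaGammaTilt_uncurry.comp (measurable_const.prodMk measurable_id)

theorem integrable_polyaGammaTilt (c : ℝ) : Integrable (polyaGammaTilt c) (polyaGamma 1 0) := by
  refine Integrable.of_bound (by fun_prop) (Real.cosh (c / 2)) ?_
  filter_upwards [ae_nonneg_polyaGamma_one 0] with x hx
  rw [Real.norm_of_nonneg (polyaGammaTilt_pos c x).le]
  exact polyaGammaTilt_le c hx

/-- The characteristic function of the tilted law at `t` is `cosh(c/2)` times the transform of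
`PG(1, 0)` at `w = it - c²/2`. With rates `λᵣ`, the `r`-th factors match: `(λᵣ(c)/λᵣ(0)) ·
λᵣ(0)/(λᵣ(c) - it) = 1/(1 - it/λᵣ(c))`. -/
theorem polyaGamma_one_eq_withDensity (c : ℝ) :
    polyaGamma 1 c =
      (polyaGamma 1 0).withDensity fun x => ENNReal.ofReal (polyaGammaTilt c x) := by
  have : IsFiniteMeasure
      ((polyaGamma 1 0).withDensity fun x => ENNReal.ofReal (polyaGammaTilt c x)) :=
    isFiniteMeasure_withDensity_ofReal (integrable_polyaGammaTilt c).2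
  refine Measure.ext_of_charFun (funext fun t => ?_)
  rw [charFun_apply_real, charFun_apply_real,
    integral_withDensity_eq_integral_toReal_smul (by fun_prop) (by simp)]
  set z : ℂ := t * Complex.I with hz
  set w : ℂ := z - ((c ^ 2 / 2 : ℝ) : ℂ) with hw
  have hzr : z.re = 0 := by simp [hz]
  have e : ∀ x : ℝ, (ENNReal.ofReal (polyaGammaTilt c x)).toReal • Complex.exp (t * x * Complex.I) =
      (Real.cosh (c / 2) : ℂ) * Complex.exp (w * x) := by
    intro x
    rw [ENNReal.toReal_ofReal (polyaGammaTilt_pos c x).le, Complex.real_smul, polyaGammaTilt,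
      Complex.ofReal_mul, mul_assoc, Complex.ofReal_exp, ← Complex.exp_add]
    congr 2
    rw [hw, hz]; push_cast; ring
  have e' : ∀ x : ℝ, Complex.exp (t * x * Complex.I) = Complex.exp (z * x) := by
    intro x; congr 1; rw [hz]; ring
  simp_rw [e, e']
  rw [integral_const_mul, polyaGamma_one_eq, polyaGamma_one_eq]
  have h1 := tendsto_prod_integral_cexp (inv_polyaGammaRate_nonneg c)
    (summable_inv_polyaGammaRate c) (z := z) hzr.le
  have h2 := tendsto_prod_integral_cexp (inv_polyaGammaRate_nonneg 0)
    (summable_inv_polyaGammaRate 0) (z := w) (by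
      rw [hw, Complex.sub_re, hzr, Complex.ofReal_re]; linarith [sq_nonneg c])
  have h3 := ((Complex.continuous_ofReal.tendsto _).comp (tendsto_prod_polyaGammaRate c)).mul h2
  refine tendsto_nhds_unique h1 (h3.congr fun n => ?_)
  simp only [Function.comp]
  rw [Complex.ofReal_prod, ← Finset.prod_mul_distrib]
  refine Finset.prod_congr rfl fun r _ => ?_
  have p0 : (polyaGammaRate 0 r : ℂ) ≠ 0 := by exact_mod_cast (polyaGammaRate_pos 0 r).ne'
  have pc : (polyaGammaRate c r : ℂ) ≠ 0 := by exact_mod_cast (polyaGammaRate_pos c r).ne'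
  have d : (polyaGammaRate c r : ℂ) - z ≠ 0 := by
    intro h
    have := congrArg Complex.re h
    rw [Complex.sub_re, hzr, Complex.ofReal_re, sub_zero, Complex.zero_re] at this
    exact (polyaGammaRate_pos c r).ne' this
  have k1 : 1 - w * (((polyaGammaRate 0 r)⁻¹ : ℝ) : ℂ) =
      ((polyaGammaRate c r : ℂ) - z) / polyaGammaRate 0 r := by
    rw [hw, polyaGammaRate_eq_add c r]
    push_cast
    field_simp
    ring
  have k2 : 1 - z * (((polyaGammaRate c r)⁻¹ : ℝ) : ℂ) =
      ((polyaGammaRate c r : ℂ) - z) / polyaGammaRate c r := by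
    push_cast
    field_simp
  rw [k1, k2]
  push_cast
  field_simp

attribute [irreducible] polyaGammaTilt

/-! ### Measures with a Lebesgue density -/

/-- `P` has the Lebesgue density `p`. -/
structure HasDensity {Z : Type*} [MeasureSpace Z] (P : Measure Z) (p : Z → ℝ) : Prop where
  measurable : Measurable p
  nonneg : ∀ z, 0 ≤ p z
  eq_withDensity : P = volume.withDensity fun z => ENNReal.ofReal (p z)

namespace HasDensity

section

variable {Z : Type*} [MeasureSpace Z] {P Q : Measure Z} {p q : Z → ℝ}

theorem absolutelyContinuous (h : HasDensity P p) : P ≪ volume :=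
  h.eq_withDensity ▸ withDensity_absolutelyContinuous _ _

theorem ae_pos (h : HasDensity P p) : ∀ᵐ z ∂P, 0 < p z := by
  rw [h.eq_withDensity, ae_withDensity_iff h.measurable.ennreal_ofReal]
  exact ae_of_all _ fun z hz => by simpa using hz

/-- The Radon-Nikodym derivative is fixed only up to Lebesgue null sets. As `Q ≪ volume`, this is
enough to compute `elbo` with explicit densities. -/
theorem logDensity_ae_eq [SigmaFinite (volume : Measure Z)] (h : HasDensity P p) :
    logDensity P =ᵐ[volume] fun z => Real.log (p z) := by
  rw [h.eq_withDensity]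
  filter_upwards [Measure.rnDeriv_withDensity (volume : Measure Z) h.measurable.ennreal_ofReal]
    with z hz
  rw [logDensity, hz, ENNReal.toReal_ofReal (h.nonneg z)]

/-- On a `P`-null set `p` vanishes Lebesgue almost everywhere, so the part where `p > 0` is Lebesgue
null and hence `Q`-null; the rest is `Q`-null by assumption. -/
theorem absolutelyContinuous_of_ae_pos (hP : HasDensity P p) (hQ : HasDensity Q q)
    (hpos : ∀ᵐ z ∂Q, 0 < p z) : Q ≪ P := by
  refine Measure.AbsolutelyContinuous.mk fun A _ hPA => ?_
  rw [hP.eq_withDensity, withDensity_apply_eq_zero hP.measurable.ennreal_ofReal] at hPA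
  refine measure_mono_null (t := ({z | ENNReal.ofReal (p z) ≠ 0} ∩ A) ∪ {z | ¬ 0 < p z}) ?_
    (measure_union_null (hQ.absolutelyContinuous hPA) hpos)
  intro z hz
  by_cases h : 0 < p z
  · exact Or.inl ⟨by simpa using h, hz⟩
  · exact Or.inr h

theorem congr (h : HasDensity P p) (hpq : ∀ z, p z = q z) : HasDensity P q :=
  funext hpq ▸ h

theorem integrable [IsFiniteMeasure P] (h : HasDensity P p) : Integrable p := by
  refine ⟨h.measurable.aestronglyMeasurable, ?_⟩
  rw [hasFiniteIntegral_iff_ofReal (ae_of_all _ h.nonneg), ← setLIntegral_univ,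
    ← withDensity_apply _ MeasurableSet.univ, ← h.eq_withDensity]
  exact measure_lt_top _ _

theorem withDensity (h : HasDensity P p) (hq : Measurable q) (hq0 : ∀ z, 0 ≤ q z) :
    HasDensity (P.withDensity fun z => ENNReal.ofReal (q z)) fun z => q z * p z where
  measurable := hq.mul h.measurable
  nonneg z := mul_nonneg (hq0 z) (h.nonneg z)
  eq_withDensity := by
    rw [h.eq_withDensity, ← withDensity_mul _ h.measurable.ennreal_ofReal hq.ennreal_ofReal]
    congr 1
    ext z
    rw [Pi.mul_apply, mul_comm (q z), ENNReal.ofReal_mul (h.nonneg z)]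

theorem elboWellDefined [SigmaFinite (volume : Measure Z)] (hP : HasDensity P p)
    (hQ : HasDensity Q q) (hpos : ∀ᵐ z ∂Q, 0 < p z)
    (hip : Integrable (fun z => Real.log (p z)) Q) (hiq : Integrable (fun z => Real.log (q z)) Q) :
    ElboWellDefined P Q :=
  ⟨hP.absolutelyContinuous, hQ.absolutelyContinuous, hP.absolutelyContinuous_of_ae_pos hQ hpos,
    hip.congr (hQ.absolutelyContinuous.ae_eq hP.logDensity_ae_eq).symm,
    hiq.congr (hQ.absolutelyContinuous.ae_eq hQ.logDensity_ae_eq).symm⟩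

theorem elbo_eq [SigmaFinite (volume : Measure Z)] (hP : HasDensity P p) (hQ : HasDensity Q q) :
    elbo P Q = ∫ z, Real.log (p z) ∂Q - ∫ z, Real.log (q z) ∂Q := by
  rw [elbo, integral_congr_ae (hQ.absolutelyContinuous.ae_eq hP.logDensity_ae_eq),
    integral_congr_ae (hQ.absolutelyContinuous.ae_eq hQ.logDensity_ae_eq)]

end

theorem prod {A B : Type*} [MeasureSpace A] [MeasureSpace B] [SFinite (volume : Measure A)]
    [SFinite (volume : Measure B)] {P : Measure A} {Q : Measure B} {p : A → ℝ} {q : B → ℝ}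
    (hP : HasDensity P p) (hQ : HasDensity Q q) :
    HasDensity (P.prod Q) fun z => p z.1 * q z.2 where
  measurable := (hP.measurable.comp measurable_fst).mul (hQ.measurable.comp measurable_snd)
  nonneg z := mul_nonneg (hP.nonneg _) (hQ.nonneg _)
  eq_withDensity := by
    rw [hP.eq_withDensity, hQ.eq_withDensity,
      prod_withDensity hP.measurable.ennreal_ofReal hQ.measurable.ennreal_ofReal,
      Measure.volume_eq_prod]
    congr 1
    ext z
    exact (ENNReal.ofReal_mul (hP.nonneg _)).symm

theorem pi {ι : Type*} [Fintype ι] {A : ι → Type*} [∀ i, MeasureSpace (A i)]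
    [∀ i, SigmaFinite (volume : Measure (A i))] {P : ∀ i, Measure (A i)}
    [∀ i, IsFiniteMeasure (P i)] {p : ∀ i, A i → ℝ} (h : ∀ i, HasDensity (P i) (p i)) :
    HasDensity (Measure.pi P) fun z => ∏ i, p i (z i) where
  measurable := Finset.measurable_fun_prod _ fun i _ => (h i).measurable.comp (measurable_pi_apply i)
  nonneg z := Finset.prod_nonneg fun i _ => (h i).nonneg _
  eq_withDensity := by
    -- On a box the indicator is a product of indicators, so the integral of the product density
    -- factors.
    refine Measure.pi_eq fun s hs => ?_
    have hint : ∀ i, Integrable ((s i).indicator (p i)) := fun i =>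
      (h i).integrable.indicator (hs i)
    have h0 : ∀ i x, 0 ≤ (s i).indicator (p i) x := fun i x =>
      Set.indicator_nonneg (fun x _ => (h i).nonneg x) x
    have hmeas : MeasurableSet (Set.univ.pi s) := MeasurableSet.univ_pi hs
    rw [withDensity_apply _ hmeas, ← lintegral_indicator hmeas]
    have e1 : ∀ z : (i : ι) → A i, (Set.univ.pi s).indicator
        (fun z => ENNReal.ofReal (∏ i, p i (z i))) z =
          ENNReal.ofReal (∏ i, (s i).indicator (p i) (z i)) := by
      intro z
      by_cases hz : z ∈ Set.univ.pi s
      · rw [Set.indicator_of_mem hz]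
        congr 1
        exact Finset.prod_congr rfl fun i _ => (Set.indicator_of_mem (hz i trivial) _).symm
      · rw [Set.indicator_of_notMem hz]
        simp only [Set.mem_univ_pi, not_forall] at hz
        obtain ⟨i, hi⟩ := hz
        rw [Finset.prod_eq_zero (Finset.mem_univ i) (Set.indicator_of_notMem hi _),
          ENNReal.ofReal_zero]
    simp_rw [e1]
    rw [volume_pi, ← ofReal_integral_eq_lintegral_ofReal (Integrable.fintype_prod_dep hint)
      (ae_of_all _ fun z => Finset.prod_nonneg fun i _ => h0 i _), integral_fintype_prod_eq_prod,
      ENNReal.ofReal_prod_of_nonneg fun i _ => integral_nonneg (h0 i)]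
    refine Finset.prod_congr rfl fun i _ => ?_
    rw [ofReal_integral_eq_lintegral_ofReal (hint i) (ae_of_all _ (h0 i)), (h i).eq_withDensity,
      withDensity_apply _ (hs i), ← lintegral_indicator (hs i)]
    refine lintegral_congr fun x => ?_
    by_cases hx : x ∈ s i <;> simp [hx]

/-- This is the rule "prior times conditional density" for a hierarchical model. -/
theorem bind_dirac_prod {A B : Type*} [MeasureSpace A] [MeasureSpace B]
    [SFinite (volume : Measure A)] [SFinite (volume : Measure B)] {P : Measure A} {p : A → ℝ}
    (hP : HasDensity P p) {κ : A → Measure B} [∀ a, SFinite (κ a)] {k : A → B → ℝ}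
    (hk : Measurable (Function.uncurry k)) (hκ : ∀ a, HasDensity (κ a) (k a)) :
    HasDensity (P.bind fun a => (Measure.dirac a).prod (κ a)) fun z => p z.1 * k z.1 z.2 where
  measurable := (hP.measurable.comp measurable_fst).mul hk
  nonneg z := mul_nonneg (hP.nonneg _) ((hκ _).nonneg _)
  eq_withDensity := by
    have hm : ∀ s : Set (A × B), MeasurableSet s → Measurable fun z : A × B =>
        s.indicator (fun z => ENNReal.ofReal (k z.1 z.2)) z := fun s hs =>
      hk.ennreal_ofReal.indicator hs
    have hval : ∀ s : Set (A × B), MeasurableSet s → ∀ a, (Measure.dirac a).prod (κ a) s =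
        ∫⁻ b, s.indicator (fun z => ENNReal.ofReal (k z.1 z.2)) (a, b) := by
      intro s hs a
      rw [Measure.prod_apply hs, lintegral_dirac' _ (measurable_measure_prodMk_left hs),
        (hκ a).eq_withDensity, withDensity_apply _ (measurable_prodMk_left hs),
        ← lintegral_indicator (measurable_prodMk_left hs)]
      rfl
    -- The formula for `bind` needs a measurable kernel; joint measurability of the conditional
    -- densities supplies it.
    have hmeas : Measurable fun a => (Measure.dirac a).prod (κ a) := by
      refine Measure.measurable_of_measurable_coe _ fun s hs => ?_
      simp_rw [hval s hs]
      exact (hm s hs).lintegral_prod_right'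
    ext s hs
    have hm' : Measurable fun z : A × B =>
        s.indicator (fun z => ENNReal.ofReal (p z.1 * k z.1 z.2)) z :=
      ((hP.measurable.comp measurable_fst).mul hk).ennreal_ofReal.indicator hs
    rw [Measure.bind_apply hs hmeas.aemeasurable, withDensity_apply _ hs, ← lintegral_indicator hs,
      Measure.volume_eq_prod, lintegral_prod _ hm'.aemeasurable, hP.eq_withDensity]
    simp_rw [hval s hs]
    rw [lintegral_withDensity_eq_lintegral_mul _ hP.measurable.ennreal_ofReal
      (hm s hs).lintegral_prod_right']
    refine lintegral_congr fun a => ?_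
    refine (lintegral_const_mul (ENNReal.ofReal (p a))
      ((hm s hs).comp measurable_prodMk_left)).symm.trans (lintegral_congr fun b => ?_)
    simp only [Function.comp]
    by_cases h : (a, b) ∈ s
    · simp only [Set.indicator_of_mem h]
      exact (ENNReal.ofReal_mul (hP.nonneg a)).symm
    · simp only [Set.indicator_of_notMem h, mul_zero]

end HasDensity

/-! ### The density of `PG(1, c)` and its entropy -/

/-- A Lebesgue density of `PG(1, 0)`. -/
def polyaGammaBase (x : ℝ) : ℝ := ((polyaGamma 1 0).rnDeriv volume x).toReal

/-- A Lebesgue density of `PG(1, c)`. -/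
def polyaGammaPDF (c x : ℝ) : ℝ := polyaGammaTilt c x * polyaGammaBase x

@[fun_prop]
theorem measurable_polyaGammaBase : Measurable polyaGammaBase :=
  (Measure.measurable_rnDeriv _ _).ennreal_toReal

theorem polyaGamma_one_absolutelyContinuous (c : ℝ) : polyaGamma 1 c ≪ (volume : Measure ℝ) :=
  Measure.absolutelyContinuous_of_le_smul (polyaGamma_one_le c)

theorem hasDensity_polyaGammaBase : HasDensity (polyaGamma 1 0) polyaGammaBase where
  measurable := measurable_polyaGammaBase
  nonneg _ := ENNReal.toReal_nonneg
  eq_withDensity := by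
    conv_lhs =>
      rw [← Measure.withDensity_rnDeriv_eq _ _ (polyaGamma_one_absolutelyContinuous 0)]
    refine withDensity_congr_ae ?_
    filter_upwards [Measure.rnDeriv_lt_top (polyaGamma 1 0) volume] with x hx
    exact (ENNReal.ofReal_toReal hx.ne).symm

/-- This version of the density is jointly measurable in `(c, x)` and has the same base factor for
every `c`, so that factor can cancel between `p` and `q`. -/
theorem hasDensity_polyaGamma (c : ℝ) : HasDensity (polyaGamma 1 c) (polyaGammaPDF c) := by
  rw [polyaGamma_one_eq_withDensity]
  exact hasDensity_polyaGammaBase.withDensity (measurable_polyaGammaTilt c)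
    fun x => (polyaGammaTilt_pos c x).le

theorem polyaGammaBase_le_ae : ∀ᵐ x : ℝ, polyaGammaBase x ≤ polyaGammaRate 0 0 := by
  have h : ∀ᵐ x : ℝ, (polyaGamma 1 0).rnDeriv volume x ≤ ENNReal.ofReal (polyaGammaRate 0 0) := by
    refine ae_le_of_forall_setLIntegral_le_of_sigmaFinite (Measure.measurable_rnDeriv _ _)
      fun s hs _ => ?_
    rw [setLIntegral_const]
    exact (Measure.setLIntegral_rnDeriv_le s).trans (polyaGamma_one_le 0 s)
  filter_upwards [h] with x hx
  exact ENNReal.toReal_le_of_le_ofReal (polyaGammaRate_pos 0 0).le hx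

theorem ae_polyaGammaBase_pos (c : ℝ) : ∀ᵐ x ∂polyaGamma 1 c, 0 < polyaGammaBase x := by
  filter_upwards [(hasDensity_polyaGamma c).ae_pos] with x hx
  exact pos_of_mul_pos_right hx (polyaGammaTilt_pos c x).le

/-- A bounded density with a finite first moment has a finite entropy. -/
theorem integrable_mul_log_of_bounded {p : ℝ → ℝ} (hp : Measurable p) (h0 : ∀ x, 0 ≤ p x) {R : ℝ}
    (hR : ∀ᵐ x, p x ≤ R) (hint : Integrable p) (hmom : Integrable fun x => p x * |x|) :
    Integrable fun x => p x * Real.log (p x) := by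
  have hexp : Integrable fun x : ℝ => Real.exp (-(1 / 2) * |x|) := by
    rw [← integrableOn_univ, ← Set.Iic_union_Ioi (a := (0 : ℝ))]
    refine IntegrableOn.union ?_ ?_
    · refine (integrableOn_exp_mul_Iic (a := 1 / 2) (by norm_num) 0).congr_fun (fun x hx => ?_)
        measurableSet_Iic
      simp only [abs_of_nonpos (Set.mem_Iic.1 hx)]
      congr 1; ring
    · refine (integrableOn_exp_mul_Ioi (a := -(1 / 2)) (by norm_num) 0).congr_fun (fun x hx => ?_)
        measurableSet_Ioi
      simp only [abs_of_pos (Set.mem_Ioi.1 hx)]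
  refine Integrable.mono' ((hexp.const_mul 2).add (hmom.add (hint.mul_const |Real.log R|)))
    (Measurable.aestronglyMeasurable (by fun_prop)) ?_
  filter_upwards [hR] with x hx
  simp only [Pi.add_apply]
  rw [Real.norm_eq_abs, abs_mul, abs_of_nonneg (h0 x)]
  have hE := Real.exp_pos (-(1 / 2) * |x|)
  have hm := mul_nonneg (h0 x) (abs_nonneg x)
  have hl := mul_nonneg (h0 x) (abs_nonneg (Real.log R))
  rcases (h0 x).eq_or_lt with hpx | hpx
  · rw [← hpx]; simp; positivity
  -- Where `p ≤ exp(-|x|)`, the bound `|log p| ≤ 2/√p` gives `p |log p| ≤ 2√p ≤ 2 exp(-|x|/2)`.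
  -- Elsewhere `-|x| < log p ≤ log R`, and the first moment suffices.
  rcases le_or_gt (p x) (Real.exp (-|x|)) with hle | hgt
  · have hle1 : p x ≤ 1 := hle.trans (Real.exp_le_one_iff.2 (neg_nonpos.2 (abs_nonneg x)))
    have hs : 0 < √(p x) := Real.sqrt_pos.2 hpx
    have hlog : |Real.log (p x)| ≤ 2 * (√(p x))⁻¹ := by
      rw [abs_of_nonpos (Real.log_nonpos hpx.le hle1)]
      have h1 := Real.add_one_le_exp (Real.log (√(p x))⁻¹)
      rw [Real.exp_log (inv_pos.2 hs), Real.log_inv, Real.log_sqrt hpx.le] at h1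
      linarith
    have hsq : √(p x) ≤ Real.exp (-(1 / 2) * |x|) := by
      rw [Real.sqrt_le_left hE.le, ← Real.exp_nat_mul]
      refine hle.trans (le_of_eq ?_)
      congr 1; push_cast; ring
    calc p x * |Real.log (p x)| ≤ p x * (2 * (√(p x))⁻¹) := by gcongr
      _ = 2 * √(p x) := by
        nth_rewrite 1 [← Real.mul_self_sqrt hpx.le]
        field_simp
      _ ≤ _ := by linarith
  · have h1 : -|x| ≤ Real.log (p x) := (Real.le_log_iff_exp_le hpx).2 hgt.le
    have h2 : Real.log (p x) ≤ Real.log R := Real.log_le_log hpx hx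
    have h3 : |Real.log (p x)| ≤ |x| + |Real.log R| :=
      abs_le.2 ⟨by linarith [abs_nonneg (Real.log R)],
        by linarith [abs_nonneg x, le_abs_self (Real.log R)]⟩
    nlinarith [mul_le_mul_of_nonneg_left h3 hpx.le]

/-- For `c = 0` this is finiteness of the entropy. The general case follows because the tilt is
bounded by `cosh(c/2)` on the half line carrying the law. -/
theorem integrable_log_polyaGammaBase (c : ℝ) :
    Integrable (fun x => Real.log (polyaGammaBase x)) (polyaGamma 1 c) := by
  have hD := hasDensity_polyaGammaBase
  have hmem : ∀ f : ℝ → ℝ, Integrable f (polyaGamma 1 0) ↔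
      Integrable fun x => polyaGammaBase x * f x := by
    intro f
    conv_lhs => rw [hD.eq_withDensity]
    rw [integrable_withDensity_iff_integrable_smul' hD.measurable.ennreal_ofReal (by simp)]
    simp_rw [ENNReal.toReal_ofReal (hD.nonneg _), smul_eq_mul]
  have h0 : Integrable (fun x => Real.log (polyaGammaBase x)) (polyaGamma 1 0) :=
    (hmem _).2 (integrable_mul_log_of_bounded hD.measurable hD.nonneg polyaGammaBase_le_ae
      hD.integrable ((hmem _).1 (integrable_id_polyaGamma_one 0).abs))
  rw [polyaGamma_one_eq_withDensity,
    integrable_withDensity_iff_integrable_smul' (by fun_prop) (by simp)]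
  refine h0.bdd_mul (c := Real.cosh (c / 2)) (Measurable.aestronglyMeasurable (by fun_prop)) ?_
  filter_upwards [ae_nonneg_polyaGamma_one 0] with x hx
  rw [ENNReal.toReal_ofReal (polyaGammaTilt_pos c x).le,
    Real.norm_of_nonneg (polyaGammaTilt_pos c x).le]
  exact polyaGammaTilt_le c hx

attribute [irreducible] polyaGammaBase polyaGammaPDF

section Gaussian

/-! ### Multivariate Gaussian laws: density, quadratic moments, Kullback-Leibler divergence -/

variable {ι : Type*} [Fintype ι]

/-- The density of the standard Gaussian law on `ℝⁿ`. -/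
def stdGaussianPDF (x : EuclideanSpace ℝ ι) : ℝ := ∏ i, gaussianPDFReal 0 1 (x i)

theorem withDensity_map {A B : Type*} [MeasurableSpace A] [MeasurableSpace B] {ν : Measure A}
    {T : A → B} (hT : Measurable T) {f : B → ℝ≥0∞} (hf : Measurable f) :
    (ν.map T).withDensity f = (ν.withDensity (f ∘ T)).map T := by
  ext s hs
  rw [withDensity_apply _ hs, Measure.map_apply hT hs, withDensity_apply _ (hT hs),
    setLIntegral_map hs hf hT]
  rfl

theorem hasDensity_stdGaussian :
    HasDensity (stdGaussian (EuclideanSpace ℝ ι)) stdGaussianPDF where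
  measurable := by
    unfold stdGaussianPDF
    exact Finset.measurable_fun_prod _ fun i _ =>
      (measurable_gaussianPDFReal 0 1).comp (by fun_prop)
  nonneg x := Finset.prod_nonneg fun i _ => gaussianPDFReal_nonneg _ _ _
  eq_withDensity := by
    have h1 : HasDensity (gaussianReal 0 1) (gaussianPDFReal 0 1) :=
      ⟨measurable_gaussianPDFReal 0 1, gaussianPDFReal_nonneg 0 1,
        gaussianReal_of_var_ne_zero 0 one_ne_zero⟩
    have h2 := HasDensity.pi (fun _ : ι => h1)
    rw [← map_pi_eq_stdGaussian, h2.eq_withDensity, ← (PiLp.volume_preserving_toLp ι).map_eq,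
      withDensity_map (by fun_prop)]
    · rfl
    · unfold stdGaussianPDF
      exact (Finset.measurable_fun_prod _ fun i _ =>
        (measurable_gaussianPDFReal 0 1).comp (by fun_prop)).ennreal_ofReal

theorem stdGaussianPDF_eq (x : EuclideanSpace ℝ ι) :
    stdGaussianPDF x =
      (√(2 * Real.pi) ^ Fintype.card ι)⁻¹ * Real.exp (-(1 / 2) * (x.ofLp ⬝ᵥ x.ofLp)) := by
  unfold stdGaussianPDF
  simp only [gaussianPDFReal, NNReal.coe_one, mul_one, sub_zero]
  rw [Finset.prod_mul_distrib, Finset.prod_const, ← Real.exp_sum, Finset.card_univ, inv_pow,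
    dotProduct, Finset.mul_sum]
  congr 2
  exact Finset.sum_congr rfl fun i _ => by ring

/-- The quadratic form `(x - a)ᵀ A (x - a)`. -/
def centeredQuad (A : Matrix ι ι ℝ) (a x : EuclideanSpace ℝ ι) : ℝ :=
  (x - a).ofLp ⬝ᵥ (A *ᵥ (x - a).ofLp)

@[fun_prop]
theorem continuous_centeredQuad (A : Matrix ι ι ℝ) (a : EuclideanSpace ℝ ι) :
    Continuous (centeredQuad A a) := by
  unfold centeredQuad
  fun_prop

theorem centeredQuad_eq_sum (A : Matrix ι ι ℝ) (a x : EuclideanSpace ℝ ι) :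
    centeredQuad A a x = ∑ i, ∑ j, A i j * ((x i - a i) * (x j - a j)) := by
  simp only [centeredQuad, dotProduct, mulVec, Finset.mul_sum, PiLp.sub_apply]
  exact Finset.sum_congr rfl fun i _ => Finset.sum_congr rfl fun j _ => by ring

variable [DecidableEq ι]

/-- The density of `N(m, S)`. -/
def multivariateGaussianPDF (m : EuclideanSpace ℝ ι) (S : Matrix ι ι ℝ)
    (x : EuclideanSpace ℝ ι) : ℝ :=
  (√(2 * Real.pi) ^ Fintype.card ι * √S.det)⁻¹ * Real.exp (-(1 / 2) * centeredQuad S⁻¹ m x)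

theorem multivariateGaussianPDF_pos {S : Matrix ι ι ℝ} (hS : S.PosDef)
    (m x : EuclideanSpace ℝ ι) : 0 < multivariateGaussianPDF m S x := by
  have := hS.det_pos
  unfold multivariateGaussianPDF
  positivity

-- The law is the image of the standard Gaussian under `x ↦ m + Lx` with `L = √S` symmetric. The
-- Jacobian is `|det L| = √(det S)`, and `L S⁻¹ L = 1` turns the quadratic form into `xᵀx`.
open scoped MatrixOrder in
theorem hasDensity_multivariateGaussian {S : Matrix ι ι ℝ} (hS : S.PosDef)
    (m : EuclideanSpace ℝ ι) :
    HasDensity (multivariateGaussian m S) (multivariateGaussianPDF m S) where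
  measurable := by
    unfold multivariateGaussianPDF
    fun_prop
  nonneg x := (multivariateGaussianPDF_pos hS m x).le
  eq_withDensity := by
    set L : Matrix ι ι ℝ := CFC.sqrt S with hL
    have hLL : L * L = S := CFC.sqrt_mul_sqrt_self _ hS.posSemidef.nonneg
    have hLT : Lᵀ = L := by
      have := (CFC.sqrt_nonneg S).isSelfAdjoint
      rw [← conjTranspose_eq_transpose_of_trivial]
      exact this
    have hdet : L.det * L.det = S.det := by rw [← det_mul, hLL]
    have hdet0 : L.det ≠ 0 := fun h => hS.det_pos.ne' (by rw [← hdet, h, zero_mul])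
    have habs : √S.det = |L.det| := by rw [← hdet, Real.sqrt_mul_self_eq_abs]
    have hunit : IsUnit L.det := isUnit_iff_ne_zero.2 hdet0
    have hSinv : L * S⁻¹ * L = 1 := by
      rw [← hLL, Matrix.mul_inv_rev, ← mul_assoc, mul_nonsing_inv _ hunit, one_mul,
        nonsing_inv_mul _ hunit]
    let f : EuclideanSpace ℝ ι →ₗ[ℝ] EuclideanSpace ℝ ι := toEuclideanLin L
    have hf : LinearMap.det f = L.det := by
      rw [show f = toLin (PiLp.basisFun 2 ℝ ι) (PiLp.basisFun 2 ℝ ι) L from rfl,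
        LinearMap.det_toLin]
    set T : EuclideanSpace ℝ ι → EuclideanSpace ℝ ι :=
      fun x => m + toEuclideanCLM (𝕜 := ℝ) L x with hTdef
    have hTm : Measurable T := by fun_prop
    have hTvol : (volume : Measure (EuclideanSpace ℝ ι)).map T =
        ENNReal.ofReal |L.det|⁻¹ • volume := by
      have h1 : T = (fun x => m + x) ∘ f := rfl
      have h2 : Measurable f := (toEuclideanCLM (𝕜 := ℝ) L).continuous.measurable
      rw [h1, ← Measure.map_map (measurable_const_add m) h2,
        Measure.map_linearMap_addHaar_eq_smul_addHaar _ (hf ▸ hdet0), Measure.map_smul,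
        (measurePreserving_add_left volume m).map_eq, hf, abs_inv]
    have hquad : ∀ x, centeredQuad S⁻¹ m (T x) = x.ofLp ⬝ᵥ x.ofLp := by
      intro x
      simp only [centeredQuad, hTdef, add_sub_cancel_left, ofLp_toEuclideanCLM]
      have h : L *ᵥ x.ofLp = x.ofLp ᵥ* L := by rw [← vecMul_transpose, hLT]
      nth_rewrite 1 [h]
      rw [← dotProduct_mulVec, mulVec_mulVec, mulVec_mulVec, hSinv, one_mulVec]
    have hpdf : ∀ x, |L.det| * multivariateGaussianPDF m S (T x) = stdGaussianPDF x := by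
      intro x
      have h0 : |L.det| ≠ 0 := abs_ne_zero.2 hdet0
      rw [multivariateGaussianPDF, hquad, stdGaussianPDF_eq, habs]
      field_simp
    have hmeas : Measurable fun x => ENNReal.ofReal (multivariateGaussianPDF m S x) := by
      unfold multivariateGaussianPDF
      fun_prop
    -- Lebesgue measure is rewritten as a multiple of its own image under `T`, so that both sides
    -- become images under `T`.
    have hvol : (volume : Measure (EuclideanSpace ℝ ι)) =
        ENNReal.ofReal |L.det| • (volume : Measure (EuclideanSpace ℝ ι)).map T := by
      rw [hTvol, smul_smul, ← ENNReal.ofReal_mul (abs_nonneg _),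
        mul_inv_cancel₀ (abs_ne_zero.2 hdet0), ENNReal.ofReal_one, one_smul]
    rw [multivariateGaussian, ← hL, hasDensity_stdGaussian.eq_withDensity]
    conv_rhs => rw [hvol]
    rw [withDensity_smul_measure, withDensity_map hTm hmeas, ← Measure.map_smul,
      ← withDensity_smul _ (hmeas.comp hTm)]
    congr 2
    ext x
    rw [Pi.smul_apply, smul_eq_mul, Function.comp, ← ENNReal.ofReal_mul (abs_nonneg _), hpdf]

theorem log_multivariateGaussianPDF {S : Matrix ι ι ℝ} (hS : S.PosDef)
    (m x : EuclideanSpace ℝ ι) :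
    Real.log (multivariateGaussianPDF m S x) =
      -(Fintype.card ι * Real.log √(2 * Real.pi)) - 1 / 2 * Real.log S.det
        - 1 / 2 * centeredQuad S⁻¹ m x := by
  have := hS.det_pos
  unfold multivariateGaussianPDF
  rw [Real.log_mul (by positivity) (Real.exp_pos _).ne', Real.log_exp, Real.log_inv,
    Real.log_mul (by positivity) (by positivity), Real.log_pow, Real.log_sqrt this.le]
  ring

theorem memLp_eval_multivariateGaussian (m : EuclideanSpace ℝ ι) (S : Matrix ι ι ℝ) (i : ι) :
    MemLp (fun x : EuclideanSpace ℝ ι => x i) 2 (multivariateGaussian m S) :=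
  IsGaussian.memLp_two_id.continuousLinearMap_comp (EuclideanSpace.proj (𝕜 := ℝ) i)

theorem integral_eval_multivariateGaussian (m : EuclideanSpace ℝ ι) (S : Matrix ι ι ℝ) (i : ι) :
    ∫ x : EuclideanSpace ℝ ι, x i ∂multivariateGaussian m S = m i := by
  have h := (EuclideanSpace.proj (𝕜 := ℝ) i).integral_comp_comm
    (IsGaussian.integrable_id (μ := multivariateGaussian m S))
  simpa using h

theorem memLp_eval_sub_multivariateGaussian (m a : EuclideanSpace ℝ ι) (S : Matrix ι ι ℝ) (i : ι) :
    MemLp (fun x : EuclideanSpace ℝ ι => x i - a i) 2 (multivariateGaussian m S) :=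
  (memLp_eval_multivariateGaussian m S i).sub (memLp_const _)

theorem integrable_centeredQuad (A : Matrix ι ι ℝ) (a m : EuclideanSpace ℝ ι)
    (S : Matrix ι ι ℝ) : Integrable (centeredQuad A a) (multivariateGaussian m S) := by
  simp_rw [funext (centeredQuad_eq_sum A a)]
  exact integrable_finsetSum _ fun i _ => integrable_finsetSum _ fun j _ =>
    ((memLp_eval_sub_multivariateGaussian m a S i).integrable_mul
      (memLp_eval_sub_multivariateGaussian m a S j)).const_mul _

/-- Second moments about `a` split into covariance plus squared bias. The case `A = S₀⁻¹` serves the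
Gaussian log densities, and `A = xxᵀ` the second moment of the linear predictor. -/
theorem integral_centeredQuad (A : Matrix ι ι ℝ) (a m : EuclideanSpace ℝ ι)
    {S : Matrix ι ι ℝ} (hS : S.PosSemidef) :
    ∫ x, centeredQuad A a x ∂multivariateGaussian m S = (A * S).trace + centeredQuad A a m := by
  have hint : ∀ i j, Integrable
      (fun x : EuclideanSpace ℝ ι => A i j * ((x i - a i) * (x j - a j)))
      (multivariateGaussian m S) := fun i j =>
    ((memLp_eval_sub_multivariateGaussian m a S i).integrable_mul
      (memLp_eval_sub_multivariateGaussian m a S j)).const_mul _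
  have hcov : ∀ i j, ∫ x : EuclideanSpace ℝ ι, (x i - a i) * (x j - a j)
      ∂multivariateGaussian m S = S i j + (m i - a i) * (m j - a j) := by
    intro i j
    have hI : ∀ i, Integrable (fun x : EuclideanSpace ℝ ι => x i) (multivariateGaussian m S) :=
      fun i => (memLp_eval_multivariateGaussian m S i).integrable (by norm_num)
    have h := covariance_eq_sub (memLp_eval_sub_multivariateGaussian m a S i)
      (memLp_eval_sub_multivariateGaussian m a S j)
    rw [covariance_sub_const_left (hI i), covariance_sub_const_right (hI j),
      covariance_eval_multivariateGaussian hS, integral_sub (hI i) (integrable_const _),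
      integral_sub (hI j) (integrable_const _), integral_eval_multivariateGaussian,
      integral_eval_multivariateGaussian] at h
    simp only [integral_const, probReal_univ, one_smul] at h
    simp only [Pi.mul_apply] at h
    linarith
  simp_rw [centeredQuad_eq_sum]
  rw [integral_finsetSum _ fun i _ => integrable_finsetSum _ fun j _ => hint i j]
  simp_rw [integral_finsetSum _ fun j _ => hint _ j, integral_const_mul, hcov, mul_add,
    Finset.sum_add_distrib]
  congr 1
  simp only [trace, diag, mul_apply]
  refine Finset.sum_congr rfl fun i _ => Finset.sum_congr rfl fun j _ => ?_
  -- Symmetry of `S` identifies `∑ Aᵢⱼ Sᵢⱼ` with the trace of `A S`.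
  rw [← hS.isHermitian.apply i j, star_trivial]

theorem integrable_log_multivariateGaussianPDF {S₀ : Matrix ι ι ℝ} (hS₀ : S₀.PosDef)
    (m₀ m : EuclideanSpace ℝ ι) (S : Matrix ι ι ℝ) :
    Integrable (fun x => Real.log (multivariateGaussianPDF m₀ S₀ x)) (multivariateGaussian m S) := by
  simp_rw [log_multivariateGaussianPDF hS₀]
  exact (integrable_const _).sub ((integrable_centeredQuad _ _ _ _).const_mul _)

theorem integral_log_multivariateGaussianPDF {S₀ : Matrix ι ι ℝ} (hS₀ : S₀.PosDef)
    (m₀ m : EuclideanSpace ℝ ι) {S : Matrix ι ι ℝ} (hS : S.PosSemidef) :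
    ∫ x, Real.log (multivariateGaussianPDF m₀ S₀ x) ∂multivariateGaussian m S =
      -(Fintype.card ι * Real.log √(2 * Real.pi)) - 1 / 2 * Real.log S₀.det
        - 1 / 2 * ((S₀⁻¹ * S).trace + centeredQuad S₀⁻¹ m₀ m) := by
  simp_rw [log_multivariateGaussianPDF hS₀]
  rw [integral_sub (integrable_const _) ((integrable_centeredQuad _ _ _ _).const_mul _),
    integral_const_mul, integral_centeredQuad _ _ _ hS]
  simp

/-- The negative Kullback-Leibler divergence of two Gaussian laws. -/
theorem integral_log_multivariateGaussianPDF_sub {S₀ S : Matrix ι ι ℝ} (hS₀ : S₀.PosDef)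
    (hS : S.PosDef) (m₀ m : EuclideanSpace ℝ ι) :
    ∫ x, Real.log (multivariateGaussianPDF m₀ S₀ x) ∂multivariateGaussian m S -
      ∫ x, Real.log (multivariateGaussianPDF m S x) ∂multivariateGaussian m S =
    1 / 2 * (Fintype.card ι : ℝ) + 1 / 2 * Real.log S.det + 1 / 2 * Real.log (S₀⁻¹).det
      - 1 / 2 * centeredQuad S₀⁻¹ m₀ m - 1 / 2 * (S₀⁻¹ * S).trace := by
  -- The second integral is the case `S₀ = S`, `m₀ = m`; its trace `tr(S⁻¹S)` is the dimension, the
  -- source of the term `M/2`.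
  rw [integral_log_multivariateGaussianPDF hS₀ m₀ m hS.posSemidef,
    integral_log_multivariateGaussianPDF hS m m hS.posSemidef,
    nonsing_inv_mul _ (isUnit_iff_ne_zero.2 hS.det_pos.ne'), trace_one, det_nonsing_inv,
    Ring.inverse_eq_inv', Real.log_inv]
  simp [centeredQuad]
  ring

/-- The reference density is positive everywhere, so the quotient of the Lebesgue densities is a
density of one Gaussian law with respect to the other. -/
theorem llr_multivariateGaussian {S₀ S : Matrix ι ι ℝ} (hS₀ : S₀.PosDef)
    (hS : S.PosDef) (m₀ m : EuclideanSpace ℝ ι) :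
    llr (multivariateGaussian m S) (multivariateGaussian m₀ S₀) =ᵐ[multivariateGaussian m S]
      fun x => Real.log (multivariateGaussianPDF m S x) -
        Real.log (multivariateGaussianPDF m₀ S₀ x) := by
  have h₀ := hasDensity_multivariateGaussian hS₀ m₀
  have h := hasDensity_multivariateGaussian hS m
  have hac : multivariateGaussian m S ≪ multivariateGaussian m₀ S₀ :=
    h₀.absolutelyContinuous_of_ae_pos h (ae_of_all _ fun x => multivariateGaussianPDF_pos hS₀ m₀ x)
  have hmeas : Measurable fun x => ENNReal.ofReal
      (multivariateGaussianPDF m S x / multivariateGaussianPDF m₀ S₀ x) :=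
    (h.measurable.div h₀.measurable).ennreal_ofReal
  have hwd : multivariateGaussian m S = (multivariateGaussian m₀ S₀).withDensity fun x =>
      ENNReal.ofReal (multivariateGaussianPDF m S x / multivariateGaussianPDF m₀ S₀ x) := by
    rw [h.eq_withDensity, h₀.eq_withDensity,
      ← withDensity_mul _ h₀.measurable.ennreal_ofReal hmeas]
    congr 1
    ext x
    rw [Pi.mul_apply, ← ENNReal.ofReal_mul (h₀.nonneg x),
      mul_div_cancel₀ _ (multivariateGaussianPDF_pos hS₀ m₀ x).ne']
  refine hac.ae_eq ?_
  have hr := Measure.rnDeriv_withDensity (multivariateGaussian m₀ S₀) hmeas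
  rw [← hwd] at hr
  filter_upwards [hr] with x hx
  rw [llr, hx, ENNReal.toReal_ofReal (div_nonneg (h.nonneg x) (h₀.nonneg x)),
    Real.log_div (multivariateGaussianPDF_pos hS m x).ne'
      (multivariateGaussianPDF_pos hS₀ m₀ x).ne']

theorem klDiv_multivariateGaussian {S₀ S : Matrix ι ι ℝ} (hS₀ : S₀.PosDef)
    (hS : S.PosDef) (m₀ m : EuclideanSpace ℝ ι) :
    klDiv (multivariateGaussian m S) (multivariateGaussian m₀ S₀) ≠ ⊤ ∧
    -(klDiv (multivariateGaussian m S) (multivariateGaussian m₀ S₀)).toReal =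
      1 / 2 * (Fintype.card ι : ℝ) + 1 / 2 * Real.log S.det + 1 / 2 * Real.log (S₀⁻¹).det
        - 1 / 2 * centeredQuad S₀⁻¹ m₀ m - 1 / 2 * (S₀⁻¹ * S).trace := by
  have hac : multivariateGaussian m S ≪ multivariateGaussian m₀ S₀ :=
    (hasDensity_multivariateGaussian hS₀ m₀).absolutelyContinuous_of_ae_pos
      (hasDensity_multivariateGaussian hS m)
      (ae_of_all _ fun x => multivariateGaussianPDF_pos hS₀ m₀ x)
  have i1 := integrable_log_multivariateGaussianPDF hS m m S
  have i0 := integrable_log_multivariateGaussianPDF hS₀ m₀ m S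
  have hllr := llr_multivariateGaussian hS₀ hS m₀ m
  refine ⟨klDiv_ne_top hac ((i1.sub i0).congr hllr.symm), ?_⟩
  -- Both measures have total mass one, so the mass correction in `klDiv` vanishes.
  rw [toReal_klDiv_of_measure_eq hac (by simp), integral_congr_ae hllr, integral_sub i1 i0,
    ← integral_log_multivariateGaussianPDF_sub hS₀ hS m₀ m]
  ring

end Gaussian

/-! ### The linear predictor and the Bernoulli-logit mass -/

section

variable {M : ℕ}

@[fun_prop]
theorem continuous_linPred (x : Fin M → ℝ) : Continuous (linPred x) := by
  unfold linPred
  fun_prop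

theorem integral_linPred (x : Fin M → ℝ) (m : EuclideanSpace ℝ (Fin M))
    (S : Matrix (Fin M) (Fin M) ℝ) :
    Integrable (linPred x) (multivariateGaussian m S) ∧
      ∫ β, linPred x β ∂multivariateGaussian m S = linPred x m := by
  have h : ∀ i, Integrable (fun β : EuclideanSpace ℝ (Fin M) => x i * β i)
      (multivariateGaussian m S) := fun i =>
    ((memLp_eval_multivariateGaussian m S i).integrable (by norm_num)).const_mul _
  refine ⟨integrable_finsetSum _ fun i _ => h i, ?_⟩
  simp only [linPred]
  rw [integral_finsetSum _ fun i _ => h i]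
  simp_rw [integral_const_mul, integral_eval_multivariateGaussian]

theorem linPred_sq_eq (x : Fin M → ℝ) (β : EuclideanSpace ℝ (Fin M)) :
    linPred x β ^ 2 = centeredQuad (vecMulVec x x) 0 β := by
  rw [centeredQuad_eq_sum, linPred, sq, Finset.sum_mul_sum]
  refine Finset.sum_congr rfl fun i _ => Finset.sum_congr rfl fun j _ => ?_
  simp only [vecMulVec_apply, PiLp.zero_apply, sub_zero]
  ring

theorem integral_linPred_sq (x : Fin M → ℝ) (m : EuclideanSpace ℝ (Fin M))
    {S : Matrix (Fin M) (Fin M) ℝ} (hS : S.PosSemidef) :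
    Integrable (fun β => linPred x β ^ 2) (multivariateGaussian m S) ∧
      ∫ β, linPred x β ^ 2 ∂multivariateGaussian m S = x ⬝ᵥ (S *ᵥ x) + linPred x m ^ 2 := by
  simp_rw [linPred_sq_eq]
  refine ⟨integrable_centeredQuad _ _ _ _, ?_⟩
  rw [integral_centeredQuad _ _ _ hS, vecMulVec_mul, trace_vecMulVec,
    dotProduct_comm x (x ᵥ* S), ← dotProduct_mulVec]

end

theorem bernoulliLogitMass_pos (y : Bool) (η : ℝ) : 0 < bernoulliLogitMass y η := by
  have h : 0 < Real.exp η := Real.exp_pos η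
  cases y
  · have : Real.exp η / (1 + Real.exp η) < 1 := (div_lt_one (by positivity)).2 (by linarith)
    simpa [bernoulliLogitMass] using this
  · simp only [bernoulliLogitMass, if_true]; positivity

@[fun_prop]
theorem measurable_bernoulliLogitMass (y : Bool) : Measurable (bernoulliLogitMass y) := by
  unfold bernoulliLogitMass
  cases y <;> simp only [if_true, Bool.false_eq_true, if_false] <;> fun_prop

/-- This is the Pólya-Gamma augmentation identity `p(y | η) cosh(η/2) = exp((y - 1/2)η) / 2`: the
normalising factor of `PG(1, η)` absorbs the nonlinear part of the logistic likelihood. -/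
theorem log_bernoulliLogitMass_add (y : Bool) (η : ℝ) :
    Real.log (bernoulliLogitMass y η) + Real.log (Real.cosh (η / 2)) =
      ((if y then (1 : ℝ) else 0) - 1 / 2) * η - Real.log 2 := by
  rw [← Real.log_mul (bernoulliLogitMass_pos y η).ne' (Real.cosh_pos _).ne',
    ← Real.log_exp (((if y then (1 : ℝ) else 0) - 1 / 2) * η),
    ← Real.log_div (Real.exp_pos _).ne' two_ne_zero]
  congr 1
  have h : Real.exp η = Real.exp (η / 2) * Real.exp (η / 2) := by
    rw [← Real.exp_add]; congr 1; ring
  have hp := Real.exp_pos (η / 2)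
  rw [Real.cosh_eq, Real.exp_neg]
  cases y
  · simp only [bernoulliLogitMass, Bool.false_eq_true, if_false]
    rw [show (0 - 1 / 2) * η = -(η / 2) by ring, Real.exp_neg, h]
    field_simp
    ring
  · simp only [bernoulliLogitMass, if_true]
    rw [show (1 - 1 / 2) * η = η / 2 by ring, h]
    field_simp
    ring

/-- It comes from `2 cosh(c/2) = (1 + exp(-c)) exp(c/2)` and brings the bound to its stated form. -/
theorem log_two_add_log_cosh (c : ℝ) :
    Real.log 2 + Real.log (Real.cosh (c / 2)) = Real.log (1 + Real.exp (-c)) + 1 / 2 * c := by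
  rw [← Real.log_mul two_ne_zero (Real.cosh_pos _).ne', ← Real.log_exp (1 / 2 * c),
    ← Real.log_mul (by positivity) (Real.exp_pos _).ne']
  congr 1
  have : Real.exp (-c) * Real.exp (1 / 2 * c) = Real.exp (-(c / 2)) := by
    rw [← Real.exp_add]; congr 1; ring
  rw [Real.cosh_eq, add_mul, one_mul, this, show 1 / 2 * c = c / 2 by ring]
  ring

theorem polyaGammaPDF_pos (c : ℝ) {x : ℝ} (hx : 0 < polyaGammaBase x) : 0 < polyaGammaPDF c x := by
  unfold polyaGammaPDF
  exact mul_pos (polyaGammaTilt_pos c x) hx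

theorem log_polyaGammaPDF (c : ℝ) {x : ℝ} (hx : 0 < polyaGammaBase x) :
    Real.log (polyaGammaPDF c x) =
      Real.log (Real.cosh (c / 2)) - c ^ 2 / 2 * x + Real.log (polyaGammaBase x) := by
  rw [polyaGammaPDF, Real.log_mul (polyaGammaTilt_pos c x).ne' hx.ne', polyaGammaTilt,
    Real.log_mul (Real.cosh_pos _).ne' (Real.exp_pos _).ne', Real.log_exp]
  ring

theorem measurable_polyaGammaPDF_comp {Z : Type*} [MeasurableSpace Z] {f g : Z → ℝ}
    (hf : Measurable f) (hg : Measurable g) : Measurable fun z => polyaGammaPDF (f z) (g z) := by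
  have h : Measurable fun p : ℝ × ℝ => polyaGammaPDF p.1 p.2 := by
    unfold polyaGammaPDF
    fun_prop
  exact h.comp (hf.prodMk hg)

/-! ### One category -/

section OneCategory

variable {N M : ℕ} (X : Matrix (Fin N) (Fin M) ℝ) (μ₀ : EuclideanSpace ℝ (Fin M))
  (S₀ : Matrix (Fin M) (Fin M) ℝ) (y : Fin N → Bool) (μ : EuclideanSpace ℝ (Fin M))
  (S : Matrix (Fin M) (Fin M) ℝ) (c : Fin N → ℝ)

/-- The density `p(y_k, β_k, ω_k)`. -/
def jointDensityOne (z : EuclideanSpace ℝ (Fin M) × (Fin N → ℝ)) : ℝ :=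
  (∏ i, bernoulliLogitMass (y i) (linPred (X i) z.1)) *
    (multivariateGaussianPDF μ₀ S₀ z.1 * ∏ i, polyaGammaPDF (linPred (X i) z.1) (z.2 i))

/-- The density `q(β_k, ω_k)`. -/
def variationalDensityOne (z : EuclideanSpace ℝ (Fin M) × (Fin N → ℝ)) : ℝ :=
  multivariateGaussianPDF μ S z.1 * ∏ i, polyaGammaPDF (c i) (z.2 i)

variable {S₀ S}

theorem hasDensity_variationalLawOne (hS : S.PosDef) :
    HasDensity (variationalLawOne μ S c) (variationalDensityOne μ S c) :=
  (hasDensity_multivariateGaussian hS μ).prod (HasDensity.pi fun i => hasDensity_polyaGamma (c i))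

theorem hasDensity_pi_polyaGamma (c : Fin N → ℝ) :
    HasDensity (Measure.pi fun i => polyaGamma 1 (c i)) fun ω => ∏ i, polyaGammaPDF (c i) (ω i) :=
  HasDensity.pi (A := fun _ : Fin N => ℝ) (P := fun i => polyaGamma 1 (c i))
    (p := fun i => polyaGammaPDF (c i)) fun i => hasDensity_polyaGamma (c i)

theorem measurable_prod_polyaGammaPDF_linPred :
    Measurable fun z : EuclideanSpace ℝ (Fin M) × (Fin N → ℝ) =>
      ∏ i, polyaGammaPDF (linPred (X i) z.1) (z.2 i) := by
  exact Finset.measurable_fun_prod _ fun i _ => measurable_polyaGammaPDF_comp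
    ((continuous_linPred (X i)).measurable.comp measurable_fst)
    ((measurable_pi_apply i).comp measurable_snd)

theorem measurable_prod_bernoulliLogitMass_linPred :
    Measurable fun β : EuclideanSpace ℝ (Fin M) =>
      ∏ i, bernoulliLogitMass (y i) (linPred (X i) β) := by
  refine Finset.measurable_fun_prod _ fun i _ => ?_
  fun_prop

theorem hasDensity_latentLawOne (hS₀ : S₀.PosDef) :
    HasDensity (latentLawOne X μ₀ S₀) fun z =>
      multivariateGaussianPDF μ₀ S₀ z.1 * ∏ i, polyaGammaPDF (linPred (X i) z.1) (z.2 i) :=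
  (hasDensity_multivariateGaussian hS₀ μ₀).bind_dirac_prod
    (κ := fun β => Measure.pi fun i => polyaGamma 1 (linPred (X i) β))
    (k := fun β ω => ∏ i, polyaGammaPDF (linPred (X i) β) (ω i))
    (measurable_prod_polyaGammaPDF_linPred X) fun _ => hasDensity_pi_polyaGamma _

theorem hasDensity_jointLawOne (hS₀ : S₀.PosDef) :
    HasDensity (jointLawOne X μ₀ S₀ y) (jointDensityOne X μ₀ S₀ y) :=
  (hasDensity_latentLawOne X μ₀ hS₀).withDensity
    ((measurable_prod_bernoulliLogitMass_linPred X y).comp measurable_fst)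
    fun _ => Finset.prod_nonneg fun _ _ => (bernoulliLogitMass_pos _ _).le

instance : IsProbabilityMeasure (variationalLawOne μ S c) := by
  unfold variationalLawOne; infer_instance

theorem measurePreserving_fst_variationalLawOne :
    MeasurePreserving Prod.fst (variationalLawOne μ S c) (multivariateGaussian μ S) :=
  measurePreserving_fst

theorem measurePreserving_eval_variationalLawOne (i : Fin N) :
    MeasurePreserving (fun z : EuclideanSpace ℝ (Fin M) × (Fin N → ℝ) => z.2 i)
      (variationalLawOne μ S c) (polyaGamma 1 (c i)) :=
  (measurePreserving_eval (fun i => polyaGamma 1 (c i)) i).comp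
    (measurePreserving_snd (μ := multivariateGaussian μ S))

theorem ae_polyaGammaBase_pos_variationalLawOne :
    ∀ᵐ z ∂variationalLawOne μ S c, ∀ i, 0 < polyaGammaBase (z.2 i) :=
  ae_all_iff.2 fun i => (measurePreserving_eval_variationalLawOne μ c i).quasiMeasurePreserving.ae
    (ae_polyaGammaBase_pos (c i))

theorem jointDensityOne_pos (hS₀ : S₀.PosDef) {z : EuclideanSpace ℝ (Fin M) × (Fin N → ℝ)}
    (hz : ∀ i, 0 < polyaGammaBase (z.2 i)) : 0 < jointDensityOne X μ₀ S₀ y z :=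
  mul_pos (Finset.prod_pos fun _ _ => bernoulliLogitMass_pos _ _)
    (mul_pos (multivariateGaussianPDF_pos hS₀ _ _)
      (Finset.prod_pos fun i _ => polyaGammaPDF_pos _ (hz i)))

theorem ae_jointDensityOne_pos (hS₀ : S₀.PosDef) :
    ∀ᵐ z ∂variationalLawOne μ S c, 0 < jointDensityOne X μ₀ S₀ y z :=
  (ae_polyaGammaBase_pos_variationalLawOne μ c).mono fun _ hz => jointDensityOne_pos X μ₀ y hS₀ hz

theorem log_jointDensityOne (hS₀ : S₀.PosDef) {z : EuclideanSpace ℝ (Fin M) × (Fin N → ℝ)}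
    (hz : ∀ i, 0 < polyaGammaBase (z.2 i)) :
    Real.log (jointDensityOne X μ₀ S₀ y z) =
      Real.log (multivariateGaussianPDF μ₀ S₀ z.1) +
        ∑ i, (((if y i then (1 : ℝ) else 0) - 1 / 2) * linPred (X i) z.1 - Real.log 2
          - 1 / 2 * (linPred (X i) z.1 ^ 2 * z.2 i) + Real.log (polyaGammaBase (z.2 i))) := by
  have h1 : ∀ i, polyaGammaPDF (linPred (X i) z.1) (z.2 i) ≠ 0 := fun i =>
    (polyaGammaPDF_pos _ (hz i)).ne'
  have h2 : ∀ i, bernoulliLogitMass (y i) (linPred (X i) z.1) ≠ 0 := fun i =>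
    (bernoulliLogitMass_pos _ _).ne'
  have h3 := (multivariateGaussianPDF_pos hS₀ μ₀ z.1).ne'
  rw [jointDensityOne, Real.log_mul (Finset.prod_ne_zero_iff.2 fun i _ => h2 i)
      (mul_ne_zero h3 (Finset.prod_ne_zero_iff.2 fun i _ => h1 i)),
    Real.log_mul h3 (Finset.prod_ne_zero_iff.2 fun i _ => h1 i), Real.log_prod fun i _ => h1 i,
    Real.log_prod fun i _ => h2 i, add_left_comm, ← Finset.sum_add_distrib]
  congr 1
  refine Finset.sum_congr rfl fun i _ => ?_
  rw [log_polyaGammaPDF _ (hz i), ← log_bernoulliLogitMass_add]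
  ring

theorem log_variationalDensityOne (hS : S.PosDef) {z : EuclideanSpace ℝ (Fin M) × (Fin N → ℝ)}
    (hz : ∀ i, 0 < polyaGammaBase (z.2 i)) :
    Real.log (variationalDensityOne μ S c z) =
      Real.log (multivariateGaussianPDF μ S z.1) +
        ∑ i, (Real.log (Real.cosh (c i / 2)) - c i ^ 2 / 2 * z.2 i
          + Real.log (polyaGammaBase (z.2 i))) := by
  have h1 : ∀ i, polyaGammaPDF (c i) (z.2 i) ≠ 0 := fun i =>
    (polyaGammaPDF_pos _ (hz i)).ne'
  rw [variationalDensityOne, Real.log_mul (multivariateGaussianPDF_pos hS μ z.1).ne'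
      (Finset.prod_ne_zero_iff.2 fun i _ => h1 i), Real.log_prod fun i _ => h1 i]
  congr 1
  exact Finset.sum_congr rfl fun i _ => log_polyaGammaPDF _ (hz i)

theorem integrable_snd_variationalLawOne (i : Fin N) {f : ℝ → ℝ}
    (hf : Integrable f (polyaGamma 1 (c i))) :
    Integrable (fun z : EuclideanSpace ℝ (Fin M) × (Fin N → ℝ) => f (z.2 i))
      (variationalLawOne μ S c) :=
  (measurePreserving_eval_variationalLawOne μ c i).integrable_comp_of_integrable hf

theorem integral_snd_variationalLawOne (i : Fin N) {f : ℝ → ℝ} (hf : Measurable f) :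
    ∫ z, f (z.2 i) ∂variationalLawOne μ S c = ∫ x, f x ∂polyaGamma 1 (c i) := by
  have h := measurePreserving_eval_variationalLawOne (S := S) μ c i
  rw [← h.map_eq, integral_map h.measurable.aemeasurable hf.aestronglyMeasurable]

theorem integrable_fst_variationalLawOne {f : EuclideanSpace ℝ (Fin M) → ℝ}
    (hf : Integrable f (multivariateGaussian μ S)) :
    Integrable (fun z : EuclideanSpace ℝ (Fin M) × (Fin N → ℝ) => f z.1)
      (variationalLawOne μ S c) :=
  (measurePreserving_fst_variationalLawOne μ c).integrable_comp_of_integrable hf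

theorem integral_fst_variationalLawOne {f : EuclideanSpace ℝ (Fin M) → ℝ} (hf : Measurable f) :
    ∫ z, f z.1 ∂variationalLawOne μ S c = ∫ β, f β ∂multivariateGaussian μ S := by
  have h := measurePreserving_fst_variationalLawOne (S := S) μ c
  rw [← h.map_eq, integral_map h.measurable.aemeasurable hf.aestronglyMeasurable]

theorem integrable_eval_variationalLawOne (i : Fin N) :
    Integrable (fun ω : Fin N → ℝ => ω i) (Measure.pi fun i => polyaGamma 1 (c i)) :=
  (measurePreserving_eval (fun i => polyaGamma 1 (c i)) i).integrable_comp_of_integrable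
    (integrable_id_polyaGamma_one (c i))

/-- Under `q` the two factors are independent, so a first moment of each is enough. -/
theorem integrable_linPred_sq_mul (hS : S.PosDef) (i : Fin N) :
    Integrable (fun z => linPred (X i) z.1 ^ 2 * z.2 i) (variationalLawOne μ S c) :=
  (integral_linPred_sq (X i) μ hS.posSemidef).1.mul_prod (integrable_eval_variationalLawOne c i)

theorem integral_linPred_sq_mul (i : Fin N) :
    ∫ z, linPred (X i) z.1 ^ 2 * z.2 i ∂variationalLawOne μ S c =
      (∫ β, linPred (X i) β ^ 2 ∂multivariateGaussian μ S) * ∫ x, x ∂polyaGamma 1 (c i) := by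
  have h := measurePreserving_eval (fun i => polyaGamma 1 (c i)) i
  rw [variationalLawOne, integral_prod_mul (fun β => linPred (X i) β ^ 2) fun ω : Fin N → ℝ => ω i,
    ← h.map_eq, integral_map h.measurable.aemeasurable (by fun_prop)]

theorem integrable_log_jointDensityOne (hS₀ : S₀.PosDef) (hS : S.PosDef) :
    Integrable (fun z => Real.log (jointDensityOne X μ₀ S₀ y z)) (variationalLawOne μ S c) ∧
    ∫ z, Real.log (jointDensityOne X μ₀ S₀ y z) ∂variationalLawOne μ S c =
      ∫ β, Real.log (multivariateGaussianPDF μ₀ S₀ β) ∂multivariateGaussian μ S +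
        ∑ i, (((if y i then (1 : ℝ) else 0) - 1 / 2) * linPred (X i) μ - Real.log 2
          - 1 / 2 * ((X i ⬝ᵥ (S *ᵥ X i) + linPred (X i) μ ^ 2) * ∫ x, x ∂polyaGamma 1 (c i))
          + ∫ x, Real.log (polyaGammaBase x) ∂polyaGamma 1 (c i)) := by
  have hG := integrable_fst_variationalLawOne μ c
    (integrable_log_multivariateGaussianPDF hS₀ μ₀ μ S)
  have hL := fun i => (integrable_fst_variationalLawOne μ c
    (integral_linPred (X i) μ S).1).const_mul ((if y i then (1 : ℝ) else 0) - 1 / 2)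
  have hLL := fun i => (hL i).sub
    (integrable_const (μ := variationalLawOne μ S c) (Real.log 2))
  have hQ := fun i => (integrable_linPred_sq_mul X μ c hS i).const_mul (1 / 2)
  have hB := fun i => integrable_snd_variationalLawOne (S := S) μ c i
    (integrable_log_polyaGammaBase (c i))
  have hT := fun i => ((hLL i).sub (hQ i)).add (hB i)
  have hae := (ae_polyaGammaBase_pos_variationalLawOne (S := S) μ c).mono fun z hz =>
    log_jointDensityOne X μ₀ y hS₀ hz
  refine ⟨(hG.add (integrable_finsetSum _ fun i _ => hT i)).congr
    (EventuallyEq.symm hae), ?_⟩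
  rw [integral_congr_ae hae]
  refine (integral_add hG (integrable_finsetSum _ fun i _ => hT i)).trans ?_
  rw [integral_fst_variationalLawOne μ c
    (hasDensity_multivariateGaussian hS₀ μ₀).measurable.log]
  congr 1
  refine (integral_finsetSum _ fun i _ => hT i).trans (Finset.sum_congr rfl fun i _ => ?_)
  refine (integral_add ((hLL i).sub (hQ i)) (hB i)).trans ?_
  rw [integral_snd_variationalLawOne μ c i measurable_polyaGammaBase.log]
  congr 1
  refine (integral_sub (hLL i) (hQ i)).trans ?_
  rw [integral_const_mul, integral_linPred_sq_mul, (integral_linPred_sq (X i) μ hS.posSemidef).2]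
  congr 1
  refine (integral_sub (hL i) (integrable_const _)).trans ?_
  rw [integral_const_mul, integral_fst_variationalLawOne μ c (continuous_linPred (X i)).measurable,
    (integral_linPred (X i) μ S).2]
  simp

theorem integrable_log_variationalDensityOne (hS : S.PosDef) :
    Integrable (fun z => Real.log (variationalDensityOne μ S c z)) (variationalLawOne μ S c) ∧
    ∫ z, Real.log (variationalDensityOne μ S c z) ∂variationalLawOne μ S c =
      ∫ β, Real.log (multivariateGaussianPDF μ S β) ∂multivariateGaussian μ S +
        ∑ i, (Real.log (Real.cosh (c i / 2)) - c i ^ 2 / 2 * ∫ x, x ∂polyaGamma 1 (c i)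
          + ∫ x, Real.log (polyaGammaBase x) ∂polyaGamma 1 (c i)) := by
  have hG := integrable_fst_variationalLawOne μ c
    (integrable_log_multivariateGaussianPDF hS μ μ S)
  have hC := fun i => integrable_const (μ := variationalLawOne μ S c)
    (Real.log (Real.cosh (c i / 2)))
  have hQ := fun i => (integrable_snd_variationalLawOne (S := S) μ c i
    (integrable_id_polyaGamma_one (c i))).const_mul (c i ^ 2 / 2)
  have hB := fun i => integrable_snd_variationalLawOne (S := S) μ c i
    (integrable_log_polyaGammaBase (c i))
  have hT := fun i => ((hC i).sub (hQ i)).add (hB i)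
  have hae := (ae_polyaGammaBase_pos_variationalLawOne (S := S) μ c).mono fun z hz =>
    log_variationalDensityOne μ c hS hz
  refine ⟨(hG.add (integrable_finsetSum _ fun i _ => hT i)).congr
    (EventuallyEq.symm hae), ?_⟩
  rw [integral_congr_ae hae]
  refine (integral_add hG (integrable_finsetSum _ fun i _ => hT i)).trans ?_
  rw [integral_fst_variationalLawOne μ c (hasDensity_multivariateGaussian hS μ).measurable.log]
  congr 1
  refine (integral_finsetSum _ fun i _ => hT i).trans (Finset.sum_congr rfl fun i _ => ?_)
  refine (integral_add ((hC i).sub (hQ i)) (hB i)).trans ?_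
  rw [integral_snd_variationalLawOne μ c i measurable_polyaGammaBase.log]
  congr 1
  refine (integral_sub (hC i) (hQ i)).trans ?_
  rw [integral_const_mul, integral_snd_variationalLawOne μ c i measurable_id']
  simp

theorem elboWellDefined_one (hS₀ : S₀.PosDef) (hS : S.PosDef) :
    ElboWellDefined (jointLawOne X μ₀ S₀ y) (variationalLawOne μ S c) :=
  (hasDensity_jointLawOne X μ₀ y hS₀).elboWellDefined (hasDensity_variationalLawOne μ c hS)
    (ae_jointDensityOne_pos X μ₀ y μ c hS₀)
    (integrable_log_jointDensityOne X μ₀ y μ c hS₀ hS).1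
    (integrable_log_variationalDensityOne μ c hS).1

/-- The choice of `c i` makes `E(xᵀβ)² = c i ^ 2`, so the terms `½ c i ^ 2 E ω` of `p` and `q`
cancel with `E ω` never evaluated; the integrals of `log polyaGammaBase` cancel likewise. -/
theorem elbo_one_eq (hS₀ : S₀.PosDef) (hS : S.PosDef)
    (hc : ∀ i, c i = √(X i ⬝ᵥ (S *ᵥ X i) + linPred (X i) μ ^ 2)) :
    elbo (jointLawOne X μ₀ S₀ y) (variationalLawOne μ S c) =
      (1 / 2 * (M : ℝ) + 1 / 2 * Real.log S.det + 1 / 2 * Real.log (S₀⁻¹).det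
        - 1 / 2 * centeredQuad S₀⁻¹ μ₀ μ - 1 / 2 * (S₀⁻¹ * S).trace)
      + ∑ i, (((if y i then (1 : ℝ) else 0) - 1 / 2) * linPred (X i) μ
          - Real.log (1 + Real.exp (-(c i))) - 1 / 2 * c i) := by
  have hsq : ∀ i, X i ⬝ᵥ (S *ᵥ X i) + linPred (X i) μ ^ 2 = c i ^ 2 := by
    intro i
    -- Positivity of `S` keeps the radicand nonnegative, so the square root does not take its
    -- default value `0` at a negative number.
    have h : 0 ≤ X i ⬝ᵥ (S *ᵥ X i) := by simpa using hS.posSemidef.dotProduct_mulVec_nonneg (X i)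
    rw [hc i, Real.sq_sqrt (by positivity)]
  have hkl := integral_log_multivariateGaussianPDF_sub hS₀ hS μ₀ μ
  rw [Fintype.card_fin] at hkl
  rw [(hasDensity_jointLawOne X μ₀ y hS₀).elbo_eq (hasDensity_variationalLawOne μ c hS),
    (integrable_log_jointDensityOne X μ₀ y μ c hS₀ hS).2,
    (integrable_log_variationalDensityOne μ c hS).2, ← hkl, add_sub_add_comm,
    ← Finset.sum_sub_distrib]
  congr 1
  refine Finset.sum_congr rfl fun i _ => ?_
  rw [hsq i]
  linarith [log_two_add_log_cosh (c i)]

end OneCategory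

/-! ### All categories -/

section AllCategories

variable {N M K : ℕ} (X : Matrix (Fin N) (Fin M) ℝ) (μ₀ : EuclideanSpace ℝ (Fin M))
  {S₀ : Matrix (Fin M) (Fin M) ℝ} (Y : Fin N → Fin K → Bool)
  (μ : Fin K → EuclideanSpace ℝ (Fin M)) {S : Fin K → Matrix (Fin M) (Fin M) ℝ}
  (c : Fin N → Fin K → ℝ)

theorem hasDensity_pi_pi_polyaGamma (c : Fin K → Fin N → ℝ) :
    HasDensity (Measure.pi fun k => Measure.pi fun i => polyaGamma 1 (c k i)) fun Ω =>
      ∏ k, ∏ i, polyaGammaPDF (c k i) (Ω k i) :=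
  HasDensity.pi (A := fun _ : Fin K => Fin N → ℝ)
    (P := fun k => Measure.pi fun i => polyaGamma 1 (c k i))
    (p := fun k ω => ∏ i, polyaGammaPDF (c k i) (ω i))
    fun k => hasDensity_pi_polyaGamma (c k)

theorem hasDensity_variationalLaw (hS : ∀ k, (S k).PosDef) :
    HasDensity (variationalLaw μ S c) fun z =>
      ∏ k, variationalDensityOne (μ k) (S k) (fun i => c i k) (z.1 k, z.2 k) :=
  ((HasDensity.pi fun k => hasDensity_multivariateGaussian (hS k) (μ k)).prod
    (hasDensity_pi_pi_polyaGamma fun k i => c i k)).congr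
    fun _ => Finset.prod_mul_distrib.symm

theorem hasDensity_latentLaw (K : ℕ) (hS₀ : S₀.PosDef) :
    HasDensity (latentLaw K X μ₀ S₀) fun z =>
      (∏ k, multivariateGaussianPDF μ₀ S₀ (z.1 k)) *
        ∏ k, ∏ i, polyaGammaPDF (linPred (X i) (z.1 k)) (z.2 k i) :=
  (HasDensity.pi fun _ : Fin K => hasDensity_multivariateGaussian hS₀ μ₀).bind_dirac_prod
    (κ := fun B => Measure.pi fun k => Measure.pi fun i => polyaGamma 1 (linPred (X i) (B k)))
    (k := fun B Ω => ∏ k, ∏ i, polyaGammaPDF (linPred (X i) (B k)) (Ω k i))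
    (Finset.measurable_fun_prod _ fun k _ => (measurable_prod_polyaGammaPDF_linPred X).comp
      (g := fun z : EuclideanSpace ℝ (Fin M) × (Fin N → ℝ) =>
        ∏ i, polyaGammaPDF (linPred (X i) z.1) (z.2 i))
      (f := fun z : (Fin K → EuclideanSpace ℝ (Fin M)) × (Fin K → Fin N → ℝ) => (z.1 k, z.2 k))
      (by fun_prop))
    fun _ => hasDensity_pi_pi_polyaGamma _

/-- Prior, Pólya-Gamma and Bernoulli factors regroup by category; this factorisation makes the bound
additive. -/
theorem hasDensity_jointLaw (hS₀ : S₀.PosDef) :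
    HasDensity (jointLaw X μ₀ S₀ Y) fun z =>
      ∏ k, jointDensityOne X μ₀ S₀ (fun i => Y i k) (z.1 k, z.2 k) := by
  have hm : Measurable fun z : (Fin K → EuclideanSpace ℝ (Fin M)) × (Fin K → Fin N → ℝ) =>
      ∏ k, ∏ i, bernoulliLogitMass (Y i k) (linPred (X i) (z.1 k)) := by
    refine Finset.measurable_fun_prod _ fun k _ => Finset.measurable_fun_prod _ fun i _ => ?_
    fun_prop
  refine ((hasDensity_latentLaw X μ₀ K hS₀).withDensity hm
    fun _ => Finset.prod_nonneg fun _ _ =>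
      Finset.prod_nonneg fun _ _ => (bernoulliLogitMass_pos _ _).le).congr fun z => ?_
  simp only [jointDensityOne, Finset.prod_mul_distrib]

theorem measurePreserving_category (k : Fin K) :
    MeasurePreserving (fun z : (Fin K → EuclideanSpace ℝ (Fin M)) × (Fin K → Fin N → ℝ) =>
      (z.1 k, z.2 k)) (variationalLaw μ S c)
      (variationalLawOne (μ k) (S k) fun i => c i k) :=
  (measurePreserving_eval (fun k => multivariateGaussian (μ k) (S k)) k).prod
    (measurePreserving_eval (fun k => Measure.pi fun i => polyaGamma 1 (c i k)) k)

/-- The logarithm of the product is almost surely a sum of functions of single categories, so only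
the marginals of `q` enter. It is applied to the factors of `p` and of `q` alike. -/
theorem integral_log_prod_category
    {p : Fin K → EuclideanSpace ℝ (Fin M) × (Fin N → ℝ) → ℝ} (hp : ∀ k, Measurable (p k))
    (hpos : ∀ k, ∀ᵐ z ∂variationalLawOne (μ k) (S k) fun i => c i k, 0 < p k z)
    (hint : ∀ k, Integrable (fun z => Real.log (p k z))
      (variationalLawOne (μ k) (S k) fun i => c i k)) :
    (∀ᵐ z ∂variationalLaw μ S c, 0 < ∏ k, p k (z.1 k, z.2 k)) ∧
    Integrable (fun z => Real.log (∏ k, p k (z.1 k, z.2 k))) (variationalLaw μ S c) ∧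
    ∫ z, Real.log (∏ k, p k (z.1 k, z.2 k)) ∂variationalLaw μ S c =
      ∑ k, ∫ z, Real.log (p k z) ∂variationalLawOne (μ k) (S k) fun i => c i k := by
  have hmp := measurePreserving_category (S := S) μ c
  have hpos' : ∀ᵐ z ∂variationalLaw μ S c, ∀ k, 0 < p k (z.1 k, z.2 k) :=
    ae_all_iff.2 fun k => (hmp k).quasiMeasurePreserving.ae (hpos k)
  have hlog : ∀ᵐ z ∂variationalLaw μ S c, Real.log (∏ k, p k (z.1 k, z.2 k)) =
      ∑ k, Real.log (p k (z.1 k, z.2 k)) :=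
    hpos'.mono fun z hz => Real.log_prod fun k _ => (hz k).ne'
  have hint' := fun k => (hmp k).integrable_comp_of_integrable (hint k)
  refine ⟨hpos'.mono fun z hz => Finset.prod_pos fun k _ => hz k,
    (integrable_finsetSum _ fun k _ => hint' k).congr
      (EventuallyEq.symm hlog), ?_⟩
  rw [integral_congr_ae hlog]
  refine (integral_finsetSum _ fun k _ => hint' k).trans (Finset.sum_congr rfl fun k _ => ?_)
  rw [← (hmp k).map_eq, integral_map (hmp k).measurable.aemeasurable
    (hp k).log.aestronglyMeasurable]
  rfl

theorem elboWellDefined_and_elbo_eq_sum (hS₀ : S₀.PosDef) (hS : ∀ k, (S k).PosDef) :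
    ElboWellDefined (jointLaw X μ₀ S₀ Y) (variationalLaw μ S c) ∧
    elbo (jointLaw X μ₀ S₀ Y) (variationalLaw μ S c) =
      ∑ k, elbo (jointLawOne X μ₀ S₀ fun i => Y i k)
        (variationalLawOne (μ k) (S k) fun i => c i k) := by
  -- σ-finiteness of Lebesgue measure on the product spaces is what identifies `logDensity` with the
  -- logarithm of an explicit density.
  have : SigmaFinite (volume : Measure (Fin K → EuclideanSpace ℝ (Fin M))) := by
    rw [volume_pi]; infer_instance
  have : SigmaFinite (volume : Measure (Fin K → Fin N → ℝ)) := by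
    rw [volume_pi]; infer_instance
  have : SigmaFinite (volume :
      Measure ((Fin K → EuclideanSpace ℝ (Fin M)) × (Fin K → Fin N → ℝ))) := by
    rw [Measure.volume_eq_prod]; infer_instance
  have hP := hasDensity_jointLaw X μ₀ Y hS₀
  have hQ := hasDensity_variationalLaw μ c hS
  have hPk := fun k => hasDensity_jointLawOne X μ₀ (fun i => Y i k) hS₀
  have hQk := fun k => hasDensity_variationalLawOne (μ k) (fun i => c i k) (hS k)
  obtain ⟨hpos, hip, heP⟩ := integral_log_prod_category μ c (fun k => (hPk k).measurable)
    (fun k => ae_jointDensityOne_pos X μ₀ _ (μ k) _ hS₀)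
    (fun k => (integrable_log_jointDensityOne X μ₀ _ (μ k) _ hS₀ (hS k)).1)
  obtain ⟨-, hiq, heQ⟩ := integral_log_prod_category μ c (fun k => (hQk k).measurable)
    (fun k => (hQk k).ae_pos)
    (fun k => (integrable_log_variationalDensityOne (μ k) _ (hS k)).1)
  refine ⟨hP.elboWellDefined hQ hpos hip hiq, ?_⟩
  rw [hP.elbo_eq hQ, heP, heQ, ← Finset.sum_sub_distrib]
  exact Finset.sum_congr rfl fun k _ => ((hPk k).elbo_eq (hQk k)).symm

end AllCategories

end IBLogit

end

theorem mainTheorem8 (N M K : ℕ)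
    (X : Matrix (Fin N) (Fin M) ℝ) (Y : Fin N → Fin K → Bool)
    (μ₀ : EuclideanSpace ℝ (Fin M)) (S₀ : Matrix (Fin M) (Fin M) ℝ) (hS₀ : S₀.PosDef)
    (μ : Fin K → EuclideanSpace ℝ (Fin M)) (S : Fin K → Matrix (Fin M) (Fin M) ℝ)
    (hS : ∀ k, (S k).PosDef)
    (c : Fin N → Fin K → ℝ)
    (hc : ∀ i k, c i k =
      Real.sqrt (X i ⬝ᵥ (S k *ᵥ X i) + (IBLogit.linPred (X i) (μ k)) ^ 2)) :
    IBLogit.ElboWellDefined (IBLogit.jointLaw X μ₀ S₀ Y) (IBLogit.variationalLaw μ S c) ∧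
    IBLogit.elbo (IBLogit.jointLaw X μ₀ S₀ Y) (IBLogit.variationalLaw μ S c) =
      ∑ k, IBLogit.elbo (IBLogit.jointLawOne X μ₀ S₀ fun i => Y i k)
        (IBLogit.variationalLawOne (μ k) (S k) fun i => c i k) ∧
    ∀ k,
      IBLogit.ElboWellDefined (IBLogit.jointLawOne X μ₀ S₀ fun i => Y i k)
        (IBLogit.variationalLawOne (μ k) (S k) fun i => c i k) ∧
      IBLogit.elbo (IBLogit.jointLawOne X μ₀ S₀ fun i => Y i k)
          (IBLogit.variationalLawOne (μ k) (S k) fun i => c i k) =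
        (1 / 2 * (M : ℝ) + 1 / 2 * Real.log (S k).det + 1 / 2 * Real.log (S₀⁻¹).det
          - 1 / 2 * ((μ k - μ₀).ofLp ⬝ᵥ (S₀⁻¹ *ᵥ (μ k - μ₀).ofLp))
          - 1 / 2 * (S₀⁻¹ * S k).trace)
        + ∑ i, (((if Y i k then (1 : ℝ) else 0) - 1 / 2) * IBLogit.linPred (X i) (μ k)
            - Real.log (1 + Real.exp (-(c i k))) - 1 / 2 * c i k) ∧
      klDiv (multivariateGaussian (μ k) (S k)) (multivariateGaussian μ₀ S₀) ≠ ⊤ ∧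
      -(klDiv (multivariateGaussian (μ k) (S k)) (multivariateGaussian μ₀ S₀)).toReal =
        1 / 2 * (M : ℝ) + 1 / 2 * Real.log (S k).det + 1 / 2 * Real.log (S₀⁻¹).det
          - 1 / 2 * ((μ k - μ₀).ofLp ⬝ᵥ (S₀⁻¹ *ᵥ (μ k - μ₀).ofLp))
          - 1 / 2 * (S₀⁻¹ * S k).trace := by
  obtain ⟨hwd, hsum⟩ := IBLogit.elboWellDefined_and_elbo_eq_sum X μ₀ Y μ c hS₀ hS
  refine ⟨hwd, hsum, fun k => ⟨IBLogit.elboWellDefined_one X μ₀ _ (μ k) _ hS₀ (hS k),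
    IBLogit.elbo_one_eq X μ₀ _ (μ k) _ hS₀ (hS k) fun i => hc i k, ?_⟩⟩
  have h := IBLogit.klDiv_multivariateGaussian hS₀ (hS k) μ₀ (μ k)
  rwa [Fintype.card_fin] at h
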